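/- There are a function $B:\mathbb{N}\to\mathbb{N}$ with $B(n)=\Theta(\log n)$ and $B(n)\ge 3\log_2 n$ for all $n\geq 1$, two deterministic algorithms (Alice and Bob), a constant $C$ and a polynomial $P$ such that the following holds for all integers $n\ge 16$ and $k,t\ge 0$ and every $B(n)$-distinct string $x\in\{0,1\}^n$. Given $n,k,t$ and $x$, Alice computes in at most $P(n)$ steps a message $m\in\{0,1\}^*$ of length $$|m|\;\le\; C\,\bigl(k\,\log_2 n\,\log_2\log_2\log_2 n+t\bigr),$$ and for every string $y$ obtained from $x$ by $(k,t)$ block edit errors Bob, given $n,k,t,m$ and $y$, outputs $x$ in at most $P(n)$ steps. In other words, $B(n)$-distinct binary strings of length $n$ have a polynomial-time deterministic one-way document exchange protocol for $(k,t)$ block edit errors with communication cost $O(k\log n\log\log\log n+t)$ bits. Here a string $x=x[1]\cdots x[n]$ is *$B$-distinct* if for all $i\neq j$ in $\{1,\dots,n-B+1\}$ the substrings of length $B$ of $x$ that start at the positions $i$ and $j$ are different. A string $y$ is obtained from $x$ by *$(k,t)$ block edit errors* if it arises from $x$ by a sequence of at most $k$ operations, each of which inserts a block of consecutive symbols, deletes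 a block of consecutive symbols, or moves a block of consecutive symbols of arbitrary length to another position, such that the insertions and deletions together insert and delete at most $t$ symbols. -/

import Mathlib

namespace DocExchange

/-! ### Strings and block edit errors -/

/-- A string `x` is `B`-distinct if its length-`B` substrings starting at two different positions
always differ. Positions are counted from `0`, so the admissible ones are those with
`i + B ≤ |x|`; there are none if `|x| < B`. -/
def BDistinct {α : Type*} (B : ℕ) (x : List α) : Prop :=
  ∀ i j : ℕ, i ≠ j → i + B ≤ x.length → j + B ≤ x.length →
    (x.drop i).take B ≠ (x.drop j).take B

/-- `BlockEdit s x y`: the string `y` arises from `x` by one block insertion, block deletion or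
block transposition, and `s` is the number of symbols that were inserted or deleted.
A transposition cuts out an arbitrary substring and inserts it at another position; moving `b` to
the right over `c` is the same as moving `c` to the left over `b`, so that one rule covers both
directions. -/
inductive BlockEdit {α : Type*} : ℕ → List α → List α → Prop
  | insertion (a b c : List α) : BlockEdit b.length (a ++ c) (a ++ b ++ c)
  | deletion (a b c : List α) : BlockEdit b.length (a ++ b ++ c) (a ++ c)
  | transposition (a b c d : List α) : BlockEdit 0 (a ++ b ++ c ++ d) (a ++ c ++ b ++ d)

/-- `BlockEdits k t x y`: the string `y` arises from `x` by `(k, t)` block edit errors, that is, by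
a sequence of at most `k` block insertions, block deletions and block transpositions which insert
or delete at most `t` symbols in total. -/
inductive BlockEdits {α : Type*} : ℕ → ℕ → List α → List α → Prop
  | none (k t : ℕ) (x : List α) : BlockEdits k t x x
  | step {k t s : ℕ} {x y z : List α} :
      BlockEdit s x y → BlockEdits k t y z → BlockEdits (k + 1) (s + t) x z

/-! ### A model of computation with a step count

Programs of a small LISP-like language work on binary trees, which are represented in memory by
pointers to pairs. Every elementary operation (return the empty tree, follow a pointer, allocate
a pair, test for emptiness, one transfer of control) costs one step; there is no test for equality
of whole trees and no arithmetic. This is the usual WHILE language with unit cost, whose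
polynomial-time computable functions are those of Turing machines. -/

/-- The data: binary trees without labels. -/
inductive Data : Type
  | nil : Data
  | cons : Data → Data → Data

namespace Data

/-- The first component of a pair; the empty tree stays empty. -/
def head : Data → Data
  | nil => nil
  | cons a _ => a

/-- The second component of a pair; the empty tree stays empty. -/
def tail : Data → Data
  | nil => nil
  | cons _ b => b

/-- A bit as a tree. -/
def ofBool : Bool → Data
  | false => nil
  | true => cons nil nil

/-- A binary string as the linked list of its bits. -/
def ofBits : List Bool → Data
  | [] => nil
  | b :: l => cons (ofBool b) (ofBits l)

/-- A natural number in unary. -/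
def ofNat : ℕ → Data
  | 0 => nil
  | n + 1 => cons nil (ofNat n)

end Data

/-- Programs; each of them computes a partial function from trees to trees. -/
inductive Prog : Type
  /-- return the input -/
  | id : Prog
  /-- return the empty tree -/
  | nil : Prog
  /-- return the first component of the input -/
  | head : Prog
  /-- return the second component of the input -/
  | tail : Prog
  /-- run both programs on the input and return the pair of their results -/
  | pair (p q : Prog) : Prog
  /-- run `p` on the input and then `q` on the result -/
  | seq (p q : Prog) : Prog
  /-- if `p` returns the empty tree on the input, run `q` on the input, otherwise `r` -/
  | ifNil (p q r : Prog) : Prog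
  /-- as long as `p` returns a non-empty tree on the current tree, replace that tree by the result
  of `q`; return the final tree -/
  | while (p q : Prog) : Prog

/-- `Runs p v w c`: on the input `v` the program `p` halts with the output `w` after exactly `c`
steps. -/
inductive Runs : Prog → Data → Data → ℕ → Prop
  | id (v : Data) : Runs Prog.id v v 1
  | nil (v : Data) : Runs Prog.nil v Data.nil 1
  | head (v : Data) : Runs Prog.head v v.head 1
  | tail (v : Data) : Runs Prog.tail v v.tail 1
  | pair {p q : Prog} {v a b : Data} {c d : ℕ} :
      Runs p v a c → Runs q v b d → Runs (Prog.pair p q) v (Data.cons a b) (c + d + 1)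
  | seq {p q : Prog} {v u w : Data} {c d : ℕ} :
      Runs p v u c → Runs q u w d → Runs (Prog.seq p q) v w (c + d + 1)
  | ifNil_nil {p q r : Prog} {v w : Data} {c d : ℕ} :
      Runs p v Data.nil c → Runs q v w d → Runs (Prog.ifNil p q r) v w (c + d + 1)
  | ifNil_cons {p q r : Prog} {v a b w : Data} {c d : ℕ} :
      Runs p v (Data.cons a b) c → Runs r v w d → Runs (Prog.ifNil p q r) v w (c + d + 1)
  | while_nil {p q : Prog} {v : Data} {c : ℕ} :
      Runs p v Data.nil c → Runs (Prog.while p q) v v (c + 1)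
  | while_cons {p q : Prog} {v a b u w : Data} {c d e : ℕ} :
      Runs p v (Data.cons a b) c → Runs q v u d → Runs (Prog.while p q) u w e →
      Runs (Prog.while p q) v w (c + d + e + 1)

/-- On the input `v` the program `p` halts with the output `w` after at most `T` steps. -/
def RunsWithin (p : Prog) (v w : Data) (T : ℕ) : Prop :=
  ∃ c ≤ T, Runs p v w c

/-! ### One-way document exchange -/

/-- Alice's input: the parameters `n`, `k`, `t`, which both parties know, and her string. -/
def aliceInput (n k t : ℕ) (x : List Bool) : Data :=
  .cons (.ofNat n) (.cons (.ofNat k) (.cons (.ofNat t) (.ofBits x)))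

/-- Bob's input: the parameters `n`, `k`, `t`, Alice's message and his own string. -/
def bobInput (n k t : ℕ) (msg y : List Bool) : Data :=
  .cons (.ofNat n) (.cons (.ofNat k) (.cons (.ofNat t) (.cons (.ofBits msg) (.ofBits y))))

/-- The deterministic programs `alice` and `bob` form a one-way document exchange protocol against
`(k, t)` block edit errors for Alice's string `x`, with communication cost at most `cost` bits and
running time at most `time` for each party: on `x` Alice computes one message `msg` of at most
`cost` bits, and from `msg` and any corrupted version `y` of `x` Bob recovers `x`. -/
def Exchanges (alice bob : Prog) (k t : ℕ) (x : List Bool) (cost : ℝ) (time : ℕ) : Prop :=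
  ∃ msg : List Bool,
    RunsWithin alice (aliceInput x.length k t x) (.ofBits msg) time ∧
    (msg.length : ℝ) ≤ cost ∧
    ∀ y : List Bool, BlockEdits k t x y →
      RunsWithin bob (bobInput x.length k t msg y) (.ofBits x) time

end DocExchange

set_option linter.unnecessarySeqFocus false

namespace DocExchange

/-! ### Polynomial-time functions on encoded data -/

/-! Write `L = lg n`, about `log n`, and take `B n = 3 * L`. Both parties sample positions of their
own strings by a rule that is local and makes the sampled set sparse and, on Alice's string, dense
enough. Alice describes the set of windows of length `8 * L` at her sampled positions relative to
the unknown, similar set of Bob, and Bob glues the windows together.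

Sampling. Starting from all positions, pass from separation `D` to `2 * D` for `D = 1, 2, 4, …` up
to about `L`. Among points of mutual distance at least `D`, those closer than `2 * D` form paths.
Three rounds of deterministic coin tossing, started from the pairwise different windows of length `3
* L`, colour the paths with `O(log log log n)` colours, and a greedy choice colour by colour thins
them (`separated_thinUpTo`, `Covers.thin`). One such pass looks only `O(D * numColours L)` far, and
these distances form a geometric series, so the samples of two strings agree on a common piece
except within `radius L = O(L * numColours L)` of its ends (`agreeOn_sample`).

Errors. A block edit leaves at most four common pieces. Each piece loses only windows sampled near
its ends, `O(numColours L)` of them, and a block of `s` symbols contains `O(s / L + 1)` samples.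
Hence the two sets of windows differ in at most `errorBound n k t` elements
(`BlockEdits.card_symmDiff_le`); no distinctness of Bob's string is needed.

Set reconciliation. Windows become residues modulo a prime of polynomial size. With `d = errorBound
n k t`, Alice sends the first `2 * d` power sums of her set. Subtracting his own, Bob gets an
exponential sum with coefficients `±1` over the symmetric difference. The common roots of all its
linear recurrences of length `d` are exactly the nodes (`forall_recSpace_iff`, Prony's method), and
Gaussian elimination finds them. Toggling them gives Alice's set. A residue costs `O(L)` bits, so
the message has `O(k log n log log log n + t)` bits.

Gluing. Alice adds a prefix of length `8 * L`. The last `3 * L` known symbols occur only once in her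
string, and some sampled window contains them together with the next symbol (`extend_take`).

For the running time, the functions above are shown to lie in a class `PT` closed under composition
and bounded loops. As `k` and `t` are arbitrary unary numbers, both programs first replace them by
their minima with `n`; no errors and very many errors are treated separately. -/

theorem RunsWithin.mono {p : Prog} {v w : Data} {S T : ℕ} (h : RunsWithin p v w S) (hST : S ≤ T) :
    RunsWithin p v w T :=
  let ⟨c, hc, hr⟩ := h
  ⟨c, hc.trans hST, hr⟩

theorem RunsWithin.seq {p q : Prog} {v u w : Data} {S T : ℕ} (hp : RunsWithin p v u S)
    (hq : RunsWithin q u w T) : RunsWithin (.seq p q) v w (S + T + 1) :=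
  let ⟨_, hc, hr⟩ := hp
  let ⟨_, hd, hs⟩ := hq
  ⟨_, by omega, .seq hr hs⟩

theorem RunsWithin.pair {p q : Prog} {v a b : Data} {S T : ℕ} (hp : RunsWithin p v a S)
    (hq : RunsWithin q v b T) : RunsWithin (.pair p q) v (.cons a b) (S + T + 1) :=
  let ⟨_, hc, hr⟩ := hp
  let ⟨_, hd, hs⟩ := hq
  ⟨_, by omega, .pair hr hs⟩

theorem RunsWithin.ifNil_nil {p q r : Prog} {v w : Data} {S T : ℕ} (hp : RunsWithin p v .nil S)
    (hq : RunsWithin q v w T) : RunsWithin (.ifNil p q r) v w (S + T + 1) :=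
  let ⟨_, hc, hr⟩ := hp
  let ⟨_, hd, hs⟩ := hq
  ⟨_, by omega, .ifNil_nil hr hs⟩

theorem RunsWithin.ifNil_cons {p q r : Prog} {v a b w : Data} {S T : ℕ}
    (hp : RunsWithin p v (.cons a b) S) (hq : RunsWithin r v w T) :
    RunsWithin (.ifNil p q r) v w (S + T + 1) :=
  let ⟨_, hc, hr⟩ := hp
  let ⟨_, hd, hs⟩ := hq
  ⟨_, by omega, .ifNil_cons hr hs⟩

theorem RunsWithin.while_nil {p q : Prog} {v : Data} {S : ℕ} (hp : RunsWithin p v .nil S) :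
    RunsWithin (.while p q) v v (S + 1) :=
  let ⟨_, hc, hr⟩ := hp
  ⟨_, by omega, .while_nil hr⟩

theorem RunsWithin.while_cons {p q : Prog} {v a b u w : Data} {S T U : ℕ}
    (hp : RunsWithin p v (.cons a b) S) (hq : RunsWithin q v u T)
    (hw : RunsWithin (.while p q) u w U) : RunsWithin (.while p q) v w (S + T + U + 1) :=
  let ⟨_, hc, hr⟩ := hp
  let ⟨_, hd, hs⟩ := hq
  let ⟨_, he, ht⟩ := hw
  ⟨_, by omega, .while_cons hr hs ht⟩

theorem RunsWithin.of_runs {p : Prog} {v w : Data} {c : ℕ} (h : Runs p v w c) :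
    RunsWithin p v w c := ⟨c, le_rfl, h⟩

/-! ### Encoding of data types as trees, and the sizes of the trees -/

/-- The number of nodes of a tree. -/
def Data.size : Data → ℕ
  | nil => 1
  | cons a b => a.size + b.size + 1

theorem Data.size_pos (d : Data) : 0 < d.size := by cases d <;> simp [Data.size]

/-- Types whose elements are represented by trees. -/
class Enc (α : Type) where
  /-- The tree that represents an element. -/
  enc : α → Data

open Enc

/-- A list of trees as a tree. -/
def encList {α : Type} [Enc α] : List α → Data
  | [] => .nil
  | a :: l => .cons (enc a) (encList l)

instance : Enc Unit := ⟨fun _ => .nil⟩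
instance : Enc Bool := ⟨Data.ofBool⟩
instance : Enc ℕ := ⟨Data.ofNat⟩
-- With propositions encoded, `PT P` says that the predicate `P` is decidable in polynomial time,
-- and connectives and bounded quantifiers become ordinary functions for `fun_prop`.
open scoped Classical in
noncomputable instance : Enc Prop := ⟨fun P => Data.ofBool (decide P)⟩
instance {α : Type} [Enc α] : Enc (List α) := ⟨encList⟩
instance {α β : Type} [Enc α] [Enc β] : Enc (α × β) := ⟨fun p => .cons (enc p.1) (enc p.2)⟩

/-- The size of the representation. -/
def sz {α : Type} [Enc α] (a : α) : ℕ := (enc a).size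

section

variable {α β γ δ σ : Type} [Enc α] [Enc β] [Enc γ] [Enc δ] [Enc σ]

@[simp] theorem enc_list_nil : enc ([] : List α) = .nil := rfl
@[simp] theorem enc_list_cons (a : α) (l : List α) : enc (a :: l) = .cons (enc a) (enc l) := rfl
@[simp] theorem enc_prod (a : α) (b : β) : enc (a, b) = .cons (enc a) (enc b) := rfl
@[simp] theorem enc_zero : enc (0 : ℕ) = .nil := rfl
@[simp] theorem enc_succ (n : ℕ) : enc (n + 1) = .cons .nil (enc n) := rfl
@[simp] theorem enc_true : enc true = .cons .nil .nil := rfl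
@[simp] theorem enc_false : enc false = .nil := rfl

theorem enc_of_true {P : Prop} (h : P) : enc P = .cons .nil .nil := by
  simp [enc, h, Data.ofBool]

theorem enc_of_not {P : Prop} (h : ¬P) : enc P = .nil := by
  simp [enc, h, Data.ofBool]

theorem sz_pos (a : α) : 0 < sz a := Data.size_pos _

@[simp] theorem sz_pair (a : α) (b : β) : sz (a, b) = sz a + sz b + 1 := rfl
@[simp] theorem sz_list_nil : sz ([] : List α) = 1 := rfl
@[simp] theorem sz_list_cons (a : α) (l : List α) : sz (a :: l) = sz a + sz l + 1 := rfl

@[simp] theorem sz_nat (n : ℕ) : sz n = 2 * n + 1 := by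
  induction n with
  | zero => rfl
  | succ n ih =>
    have : sz (n + 1) = 1 + sz n + 1 := rfl
    omega

theorem sz_bool_le (b : Bool) : sz b ≤ 3 := by cases b <;> decide

theorem sz_le_of_mem {a : α} {l : List α} (h : a ∈ l) : sz a ≤ sz l := by
  induction l with
  | nil => simp at h
  | cons b l ih =>
    rcases List.mem_cons.1 h with rfl | h
    · simp; omega
    · have := ih h; simp; omega

theorem length_lt_sz (l : List α) : l.length < sz l := by
  induction l with
  | nil => simp
  | cons b l ih => simp; omega

theorem sz_list_le {l : List α} {M : ℕ} (h : ∀ a ∈ l, sz a ≤ M) :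
    sz l ≤ l.length * (M + 1) + 1 := by
  induction l with
  | nil => simp
  | cons b l ih =>
    have h1 := ih fun a ha => h a (List.mem_cons_of_mem _ ha)
    have h2 := h b (by simp)
    simp only [sz_list_cons, List.length_cons, Nat.add_mul, Nat.one_mul] at *
    omega

theorem sz_sublist {l l' : List α} (h : l.Sublist l') : sz l ≤ sz l' := by
  induction h with
  | slnil => simp
  | cons a _ ih => simp; omega
  | cons_cons a _ ih => simp; omega

theorem eval_mono (P : Polynomial ℕ) {a b : ℕ} (h : a ≤ b) : P.eval a ≤ P.eval b := by
  simp only [Polynomial.eval_eq_sum_range]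
  gcongr

/-! ### Closure properties of the class of polynomial-time functions -/

/-- A function between encoded types is `PT` if a program computes it in polynomial time and the
size of the values is polynomially bounded. -/
@[fun_prop]
def PT (f : α → β) : Prop :=
  ∃ (p : Prog) (T : Polynomial ℕ), ∀ a, RunsWithin p (enc a) (enc (f a)) (T.eval (sz a)) ∧
    sz (f a) ≤ T.eval (sz a)

@[fun_prop]
theorem PT.self : PT (fun a : α => a) :=
  ⟨.id, Polynomial.X + 1, fun a => ⟨(RunsWithin.of_runs (.id _)).mono (by simp),
    by simp⟩⟩

theorem exists_prog_const (d : Data) : ∃ (p : Prog) (c : ℕ), ∀ v, RunsWithin p v d c := by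
  induction d with
  | nil => exact ⟨.nil, 1, fun v => .of_runs (.nil v)⟩
  | cons a b iha ihb =>
    obtain ⟨p, c, hp⟩ := iha
    obtain ⟨q, d, hq⟩ := ihb
    exact ⟨.pair p q, c + d + 1, fun v => (hp v).pair (hq v)⟩

@[fun_prop]
theorem PT.const (b : β) : PT (fun _ : α => b) := by
  obtain ⟨p, c, hp⟩ := exists_prog_const (enc b)
  exact ⟨p, Polynomial.C (c + sz b), fun a => ⟨(hp _).mono (by simp), by simp⟩⟩

-- The size bound in `PT` is what makes composition work. It does not follow from the time bound,
-- because `pair id id` doubles the size of a tree at constant cost.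
@[fun_prop]
theorem PT.comp {g : β → γ} {f : α → β} (hg : PT g) (hf : PT f) : PT (fun a => g (f a)) := by
  obtain ⟨p, T, hp⟩ := hf
  obtain ⟨q, U, hq⟩ := hg
  refine ⟨.seq p q, T + U.comp T + 1, fun a => ⟨(((hp a).1.seq (hq _).1)).mono ?_,
    (hq _).2.trans ?_⟩⟩
  · have := eval_mono U (hp a).2
    simp only [Polynomial.eval_add, Polynomial.eval_comp, Polynomial.eval_one]
    omega
  · have := eval_mono U (hp a).2
    simp only [Polynomial.eval_add, Polynomial.eval_comp, Polynomial.eval_one]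
    omega

@[fun_prop]
theorem PT.prodMk {f : α → β} {g : α → γ} (hf : PT f) (hg : PT g) : PT (fun a => (f a, g a)) := by
  obtain ⟨p, T, hp⟩ := hf
  obtain ⟨q, U, hq⟩ := hg
  refine ⟨.pair p q, T + U + 1, fun a => ⟨((hp a).1.pair (hq a).1).mono ?_, ?_⟩⟩
  · simp
  · have := (hp a).2
    have := (hq a).2
    simp
    omega

@[fun_prop]
theorem PT.fst : PT (fun p : α × β => p.1) :=
  ⟨.head, Polynomial.X + 1, fun a => ⟨(RunsWithin.of_runs (.head _)).mono (by simp), by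
    rcases a with ⟨a, b⟩; simp; omega⟩⟩

@[fun_prop]
theorem PT.snd : PT (fun p : α × β => p.2) :=
  ⟨.tail, Polynomial.X + 1, fun a => ⟨(RunsWithin.of_runs (.tail _)).mono (by simp), by
    rcases a with ⟨a, b⟩; simp; omega⟩⟩

theorem PT.cons' : PT (fun p : α × List α => p.1 :: p.2) :=
  ⟨.id, Polynomial.X + 1, fun a => ⟨(RunsWithin.of_runs (.id _)).mono (by simp), by
    rcases a with ⟨a, b⟩; simp⟩⟩

@[fun_prop]
theorem PT.cons {f : α → β} {g : α → List β} (hf : PT f) (hg : PT g) :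
    PT (fun a => f a :: g a) := PT.cons'.comp (hf.prodMk hg)

@[fun_prop]
theorem PT.tail : PT (fun l : List α => l.tail) :=
  ⟨.tail, Polynomial.X + 1, fun a => ⟨by
    rcases a with _ | ⟨a, l⟩ <;> exact (RunsWithin.of_runs (.tail _)).mono (by simp), by
    rcases a with _ | ⟨a, b⟩ <;> simp; omega⟩⟩

@[fun_prop]
theorem PT.succ : PT (fun n : ℕ => n + 1) :=
  ⟨.pair .nil .id, 2 * Polynomial.X + 3, fun a =>
    ⟨((RunsWithin.of_runs (.nil _)).pair (.of_runs (.id _))).mono (by simp), by simp; omega⟩⟩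

@[fun_prop]
theorem PT.pred : PT (fun n : ℕ => n - 1) :=
  ⟨.tail, Polynomial.X + 1, fun a => ⟨by
    rcases a with _ | a <;> exact (RunsWithin.of_runs (.tail _)).mono (by simp),
    by simp; omega⟩⟩

/-- Branching on an encoding. -/
theorem PT.ifNil {f g h : α → β} {c : α → γ} (hc : PT c) (hf : PT f) (hg : PT g)
    (h0 : ∀ a, enc (c a) = .nil → h a = f a) (h1 : ∀ a, enc (c a) ≠ .nil → h a = g a) : PT h := by
  obtain ⟨p, T, hp⟩ := hc
  obtain ⟨q, U, hq⟩ := hf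
  obtain ⟨r, V, hr⟩ := hg
  refine ⟨.ifNil p q r, T + U + V + 1, fun a => ?_⟩
  have hpa := (hp a).1
  by_cases h : enc (c a) = .nil
  · rw [h0 a h]
    rw [h] at hpa
    refine ⟨(hpa.ifNil_nil (hq a).1).mono ?_, (hq a).2.trans ?_⟩ <;> simp <;> omega
  · rw [h1 a h]
    obtain ⟨u, v, huv⟩ : ∃ u v, enc (c a) = .cons u v := by
      cases h' : enc (c a) with
      | nil => exact absurd h' h
      | cons u v => exact ⟨u, v, rfl⟩
    rw [huv] at hpa
    refine ⟨(hpa.ifNil_cons (hr a).1).mono ?_, (hr a).2.trans ?_⟩ <;> simp <;> omega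

theorem enc_prop_eq_nil {P : Prop} : enc P = .nil ↔ ¬P := by
  by_cases h : P
  · rw [enc_of_true h]; simp [h]
  · rw [enc_of_not h]; simp [h]

@[fun_prop]
theorem PT.ite {c : α → Prop} [∀ a, Decidable (c a)] {f g : α → β} (hc : PT c) (hf : PT f)
    (hg : PT g) : PT (fun a => if c a then f a else g a) :=
  PT.ifNil hc hg hf (fun a h => if_neg (enc_prop_eq_nil.1 h))
    (fun a h => if_pos (by simpa [enc_prop_eq_nil] using h))

/-- `PT` depends only on the values of a function, so it suffices to find any pointwise equal
expression that is built from known operations. Most proofs below have this form. -/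
theorem PT.congr {f g : α → β} (hf : PT f) (h : ∀ a, g a = f a) : PT g := by
  obtain rfl : g = f := funext h
  exact hf

@[fun_prop]
theorem PT.and {P Q : α → Prop} (hP : PT P) (hQ : PT Q) : PT (fun a => P a ∧ Q a) := by
  classical
  exact (hP.ite hQ (PT.const False)).congr fun a => by by_cases h : P a <;> simp [h]

@[fun_prop]
theorem PT.or {P Q : α → Prop} (hP : PT P) (hQ : PT Q) : PT (fun a => P a ∨ Q a) := by
  classical
  exact (hP.ite (PT.const True) hQ).congr fun a => by by_cases h : P a <;> simp [h]

@[fun_prop]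
theorem PT.not {P : α → Prop} (hP : PT P) : PT (fun a => ¬ P a) := by
  classical
  exact (hP.ite (PT.const False) (PT.const True)).congr fun a => by by_cases h : P a <;> simp [h]

@[fun_prop]
theorem PT.decide_prop {P : α → Prop} {_ : ∀ a, Decidable (P a)} (hP : PT P) :
    PT (fun a => decide (P a)) :=
  (hP.ite (PT.const true) (PT.const false)).congr fun a => by by_cases h : P a <;> simp [h]

@[fun_prop]
theorem PT.eq_true {b : α → Bool} (hb : PT b) : PT (fun a => b a = true) :=
  PT.ifNil hb (PT.const False) (PT.const True)
    (fun a h => by cases hb : b a <;> simp_all) (fun a h => by cases hb : b a <;> simp_all)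

@[fun_prop]
theorem PT.isNil {l : α → List β} (hl : PT l) : PT (fun a => l a = []) :=
  PT.ifNil hl (PT.const True) (PT.const False)
    (fun a h => by cases hl : l a <;> simp_all) (fun a h => by cases hl : l a <;> simp_all)

@[fun_prop]
theorem PT.headD {l : α → List β} {d : α → β} (hl : PT l) (hd : PT d) :
    PT (fun a => (l a).headD (d a)) := by
  obtain ⟨p, T, hp⟩ := hl
  obtain ⟨q, U, hq⟩ := hd
  refine ⟨.ifNil p q (.seq p .head), 2 * T + U + 3, fun a => ?_⟩
  have h1 := (hp a).1
  have h2 := (hp a).2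
  change RunsWithin _ _ (enc ((l a).headD (d a))) _ ∧ sz ((l a).headD (d a)) ≤ _
  cases h : l a with
  | nil =>
    rw [h] at h1
    refine ⟨(h1.ifNil_nil (hq a).1).mono ?_, (hq a).2.trans ?_⟩ <;> simp <;> omega
  | cons b t =>
    rw [h] at h1 h2
    refine ⟨(h1.ifNil_cons (h1.seq (.of_runs (.head _)))).mono ?_, ?_⟩
    · simp
      omega
    · simp at h2 ⊢
      omega

/-! ### Loops -/

/-- The tree in the loop is the triple of the fixed parameter `c`, the accumulator and the remaining
list. The invariant that the size of the accumulator plus `Q` per remaining element is at most `A`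
keeps every call of `q` in the range where the time bound `T` is known; `30` covers the bookkeeping
of a round. -/
theorem runsWithin_while_foldl {f : σ → α → σ} {q : Prog} {c : γ} {T A B Q : ℕ}
    (hq : ∀ acc a, sz acc ≤ A → sz a ≤ B → RunsWithin q (enc (c, acc, a)) (enc (f acc a)) T)
    (l : List α) (hf : ∀ acc, ∀ a ∈ l, sz (f acc a) ≤ sz acc + Q) (hl : sz l ≤ B) (s : σ)
    (hs : sz s + l.length * Q ≤ A) :
    RunsWithin (.while (.seq .tail .tail) (.pair .head (.pair
      (.seq (.pair .head (.pair (.seq .tail .head) (.seq .tail (.seq .tail .head)))) q)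
      (.seq .tail (.seq .tail .tail)))))
      (enc (c, s, l)) (enc (c, l.foldl f s, ([] : List α))) (l.length * (T + 30) + 4) := by
  induction l generalizing s with
  | nil =>
    exact (RunsWithin.while_nil ((RunsWithin.of_runs (.tail _)).seq (.of_runs (.tail _)))).mono
      (by simp)
  | cons a l ih =>
    have hsa : sz s ≤ A := by omega
    have haB : sz a ≤ B := by simp at hl; omega
    have h := ih (fun acc b hb => hf acc b (List.mem_cons_of_mem _ hb)) (by simp at hl; omega)
      (f s a) (by
        have := hf s a (by simp)
        simp only [List.length_cons, Nat.add_mul, Nat.one_mul] at hs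
        omega)
    have hbody := (RunsWithin.of_runs (.head (enc (c, s, a :: l)))).pair
      (((((RunsWithin.of_runs (.head (enc (c, s, a :: l)))).pair
        (((RunsWithin.of_runs (.tail (enc (c, s, a :: l)))).seq (.of_runs (.head _))).pair
        ((RunsWithin.of_runs (.tail (enc (c, s, a :: l)))).seq
          ((RunsWithin.of_runs (.tail _)).seq (.of_runs (.head _)))))).seq
        (hq s a hsa haB)).pair
      ((RunsWithin.of_runs (.tail (enc (c, s, a :: l)))).seq
          ((RunsWithin.of_runs (.tail _)).seq (.of_runs (.tail _))))))
    refine (RunsWithin.while_cons ((RunsWithin.of_runs (.tail _)).seq (.of_runs (.tail _)))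
      hbody h).mono ?_
    simp only [List.length_cons, Nat.add_mul, Nat.one_mul]
    omega

theorem sz_foldl_le {ι : Type} {f : σ → ι → σ} {Q : ℕ} (l : List ι)
    (hf : ∀ acc, ∀ a ∈ l, sz (f acc a) ≤ sz acc + Q) (s : σ) :
    sz (l.foldl f s) ≤ sz s + l.length * Q := by
  induction l generalizing s with
  | nil => simp
  | cons a l ih =>
    have h1 := ih (fun acc b hb => hf acc b (List.mem_cons_of_mem _ hb)) (f s a)
    have h2 := hf s a (by simp)
    simp only [List.foldl_cons, List.length_cons, Nat.add_mul, Nat.one_mul]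
    omega

/-- Folds whose accumulator grows by a polynomially bounded amount in each step. -/
theorem PT.foldl_of_eval {l : γ → List α} {s : γ → σ} {f : γ → σ → α → σ} (hl : PT l) (hs : PT s)
    (hf : PT (fun p : γ × σ × α => f p.1 p.2.1 p.2.2)) (Q : Polynomial ℕ)
    (hQ : ∀ c acc, ∀ a ∈ l c, sz (f c acc a) ≤ sz acc + Q.eval (sz c)) :
    PT (fun c => (l c).foldl (f c) (s c)) := by
  obtain ⟨pl, Tl, hl⟩ := hl
  obtain ⟨ps, Ts, hs⟩ := hs
  obtain ⟨q, T, hq⟩ := hf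
  -- `A` bounds every accumulator (initial size plus rounds times growth), and `U` the time of the
  -- loop body on inputs of that size.
  let A : Polynomial ℕ := Ts + Tl * Q
  let U : Polynomial ℕ := T.comp (Polynomial.X + A + Tl + 2)
  refine ⟨.seq (.seq (.pair .id (.pair ps pl)) (.while (.seq .tail .tail) (.pair .head (.pair
      (.seq (.pair .head (.pair (.seq .tail .head) (.seq .tail (.seq .tail .head)))) q)
      (.seq .tail (.seq .tail .tail)))))) (.seq .tail .head),
    A + Ts + Tl + Tl * (U + 30) + 20, fun c => ?_⟩
  have hlen : (l c).length ≤ Tl.eval (sz c) := (length_lt_sz _).le.trans (hl c).2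
  have hA : sz (s c) + (l c).length * Q.eval (sz c) ≤ A.eval (sz c) := by
    simp only [A, Polynomial.eval_add, Polynomial.eval_mul]
    exact Nat.add_le_add (hs c).2 (Nat.mul_le_mul_right _ hlen)
  have hloop := runsWithin_while_foldl (f := f c) (q := q) (c := c) (T := U.eval (sz c))
    (A := A.eval (sz c)) (B := Tl.eval (sz c)) (Q := Q.eval (sz c))
    (fun acc a h1 h2 => ((hq (c, acc, a)).1).mono (by
      simp only [U, Polynomial.eval_comp]
      apply eval_mono
      simp
      omega)) (l c) (hQ c) (hl c).2 (s c) hA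
  refine ⟨(((RunsWithin.of_runs (.id _)).pair ((hs c).1.pair (hl c).1)).seq hloop).seq
    ((RunsWithin.of_runs (.tail _)).seq (.of_runs (.head _))) |>.mono ?_, ?_⟩
  · have := Nat.mul_le_mul_right (U.eval (sz c) + 30) hlen
    simp only [Polynomial.eval_add, Polynomial.eval_mul, Polynomial.eval_ofNat]
    omega
  · have := sz_foldl_le (l c) (hQ c) (s c)
    simp only [Polynomial.eval_add, Polynomial.eval_mul, Polynomial.eval_ofNat]
    omega

/-- Folds whose accumulator grows by at most the size of a polynomial-time value in each step. -/
theorem PT.foldl {l : γ → List α} {s : γ → σ} {f : γ → σ → α → σ} {g : γ → α → δ}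
    (hl : PT l) (hs : PT s) (hf : PT (fun p : γ × σ × α => f p.1 p.2.1 p.2.2))
    (hg : PT (fun p : γ × α => g p.1 p.2))
    (h : ∀ c acc, ∀ a ∈ l c, sz (f c acc a) ≤ sz acc + sz (g c a)) :
    PT (fun c => (l c).foldl (f c) (s c)) := by
  obtain ⟨pg, Tg, hg⟩ := hg
  have ⟨pl, Tl, hl'⟩ := hl
  refine PT.foldl_of_eval hl hs hf (Tg.comp (Polynomial.X + Tl + 1)) fun c acc a ha =>
    (h c acc a ha).trans (Nat.add_le_add_left ((hg (c, a)).2.trans ?_) _)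
  rw [Polynomial.eval_comp]
  apply eval_mono
  have := sz_le_of_mem ha
  have := (hl' c).2
  simp
  omega

@[fun_prop]
theorem PT.reverse : PT (fun l : List α => l.reverse) := by
  have : PT (fun l : List α => l.foldl (fun acc a => a :: acc) []) :=
    -- A new list cell enlarges the accumulator by `sz a + 1`; pairing with `()` provides a value of
    -- at least that size.
    PT.foldl (f := fun _ acc a => a :: acc) (g := fun _ a => (a, ())) PT.self (PT.const _)
      (by fun_prop) (by fun_prop) (fun c acc a _ => by simp; omega)
  exact this.congr fun l => by simp

@[fun_prop]
theorem PT.append {l l' : α → List β} (hl : PT l) (hl' : PT l') : PT (fun a => l a ++ l' a) := by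
  have : PT (fun a => (l a).reverse.foldl (fun acc a => a :: acc) (l' a)) :=
    PT.foldl (f := fun _ acc a => a :: acc) (g := fun _ a => (a, ())) (by fun_prop) hl'
      (by fun_prop) (by fun_prop) (fun c acc a _ => by simp; omega)
  exact this.congr fun a => by simp

@[fun_prop]
theorem PT.map {l : α → List β} {f : α → β → γ} (hl : PT l)
    (hf : PT (fun p : α × β => f p.1 p.2)) : PT (fun a => (l a).map (fun b => f a b)) := by
  have : PT (fun a => ((l a).foldl (fun acc b => f a b :: acc) []).reverse) :=
    PT.reverse.comp (PT.foldl (f := fun a acc b => f a b :: acc) (g := fun a b => (f a b, ()))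
      hl (PT.const _) (by fun_prop) (by fun_prop) (fun c acc a _ => by simp; omega))
  exact this.congr fun a => by
    rw [← List.foldl_map (f := f a) (g := fun acc c => c :: acc), List.foldl_flip_cons_eq_append]
    simp

@[fun_prop]
theorem PT.filter {l : α → List β} {p : α → β → Bool} (hl : PT l)
    (hp : PT (fun q : α × β => p q.1 q.2)) : PT (fun a => (l a).filter (fun b => p a b)) := by
  have : PT (fun a => ((l a).foldl (fun acc b => if p a b then b :: acc else acc) []).reverse) :=
    PT.reverse.comp (PT.foldl (f := fun a acc b => if p a b then b :: acc else acc)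
      (g := fun a b => (b, ())) hl (PT.const _) (by fun_prop) (by fun_prop)
      (fun c acc a _ => by split <;> simp <;> omega))
  refine this.congr fun a => ?_
  have : ∀ (m acc : List β), m.foldl (fun acc b => if p a b then b :: acc else acc) acc =
      (m.filter (p a)).reverse ++ acc := by
    intro m
    induction m with
    | nil => simp
    | cons b m ih => intro acc; by_cases h : p a b <;> simp [ih, h]
  simp [this]

@[fun_prop]
theorem PT.exists_mem {l : α → List β} {P : α → β → Prop} (hl : PT l)
    (hP : PT (fun q : α × β => P q.1 q.2)) : PT (fun a => ∃ b ∈ l a, P a b) := by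
  classical
  have : PT (fun a => ¬ (l a).filter (fun b => decide (P a b)) = []) := by fun_prop
  exact this.congr fun a => by simp

/-! ### Arithmetic in unary and positions in lists -/

@[fun_prop]
theorem PT.length : PT (fun l : List α => l.length) := by
  have : PT (fun l : List α => l.foldl (fun n _ => n + 1) 0) :=
    PT.foldl (f := fun _ n _ => n + 1) (g := fun _ _ => 1) PT.self (PT.const _)
      (by fun_prop) (by fun_prop) (fun c acc a _ => by simp; omega)
  exact this.congr fun l => by simp

theorem enc_replicate (n : ℕ) : enc (List.replicate n ()) = enc n := by
  induction n with
  | zero => rfl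
  | succ n ih => rw [List.replicate_succ, enc_list_cons, ih]; rfl

/-- A unary number and a list of units are the same tree, so the identity program turns a number
into a loop counter. -/
theorem PT.replicate_unit : PT (fun n : ℕ => List.replicate n ()) :=
  ⟨.id, Polynomial.X + 1, fun n => by
    rw [sz, enc_replicate]
    exact ⟨(RunsWithin.of_runs (.id _)).mono (by simp), by simp [sz, enc_replicate]⟩⟩

/-- Iterates of a function that enlarges its argument by a polynomially bounded amount. -/
theorem PT.iterate {n : γ → ℕ} {s : γ → σ} {f : γ → σ → σ} {g : γ → δ}
    (hn : PT n) (hs : PT s) (hf : PT (fun p : γ × σ => f p.1 p.2)) (hg : PT g)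
    (h : ∀ c acc, sz (f c acc) ≤ sz acc + sz (g c)) :
    PT (fun c => (f c)^[n c] (s c)) := by
  have : PT (fun c => (List.replicate (n c) ()).foldl (fun acc _ => f c acc) (s c)) :=
    PT.foldl (f := fun c acc _ => f c acc) (g := fun c _ => g c) (PT.replicate_unit.comp hn) hs
      (by fun_prop) (by fun_prop) (fun c acc a _ => h c acc)
  refine this.congr fun c => ?_
  generalize s c = s
  induction n c generalizing s with
  | zero => rfl
  | succ n ih => simpa [List.replicate_succ] using ih (f c s)

@[fun_prop]
theorem PT.add {m n : α → ℕ} (hm : PT m) (hn : PT n) : PT (fun a => m a + n a) :=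
  (PT.iterate (f := fun _ b => b + 1) (g := fun _ => 1) hn hm (by fun_prop) (by fun_prop)
    (fun _ _ => by simp; omega)).congr fun a => by simp

@[fun_prop]
theorem PT.sub {m n : α → ℕ} (hm : PT m) (hn : PT n) : PT (fun a => m a - n a) :=
  (PT.iterate (f := fun _ b => b - 1) (g := fun _ => 1) hn hm (by fun_prop) (by fun_prop)
    (fun _ _ => by simp; omega)).congr fun a => by
      generalize n a = k
      induction k with
      | zero => rfl
      | succ k ih => rw [Function.iterate_succ_apply', ← ih, Nat.sub_add_eq]

@[fun_prop]
theorem PT.mul {m n : α → ℕ} (hm : PT m) (hn : PT n) : PT (fun a => m a * n a) :=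
  (PT.iterate (f := fun a b => b + m a) (s := fun _ => 0) (g := m) hn (by fun_prop)
    (by fun_prop) hm (fun _ _ => by simp; omega)).congr fun a => by
      simp [mul_comm]

@[fun_prop]
theorem PT.eq_zero {m : α → ℕ} (hm : PT m) : PT (fun a => m a = 0) :=
  PT.ifNil hm (PT.const True) (PT.const False)
    (fun a h => by cases h' : m a <;> simp_all) (fun a h => by cases h' : m a <;> simp_all)

@[fun_prop]
theorem PT.le {m n : α → ℕ} (hm : PT m) (hn : PT n) : PT (fun a => m a ≤ n a) :=
  (PT.eq_zero (hm.sub hn)).congr fun _ => (propext Nat.sub_eq_zero_iff_le).symm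

@[fun_prop]
theorem PT.lt {m n : α → ℕ} (hm : PT m) (hn : PT n) : PT (fun a => m a < n a) :=
  (PT.le (PT.succ.comp hm) hn).congr fun _ => rfl

@[fun_prop]
theorem PT.nat_eq {m n : α → ℕ} (hm : PT m) (hn : PT n) : PT (fun a => m a = n a) :=
  ((hm.le hn).and (hn.le hm)).congr fun a => by simp [le_antisymm_iff]

@[fun_prop]
theorem PT.nat_min {m n : α → ℕ} (hm : PT m) (hn : PT n) : PT (fun a => min (m a) (n a)) :=
  ((hm.le hn).ite hm hn).congr fun a => by simp [min_def]

@[fun_prop]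
theorem PT.range : PT (fun n : ℕ => List.range n) := by
  -- Each round puts the current length in front of the list. The growth bound of `PT.iterate` is
  -- required for all accumulators, not only for those that occur; the minimum with `n` secures it
  -- and is never active in the actual run.
  have : PT (fun n : ℕ => ((fun q : List ℕ => min q.length n :: q)^[n] []).reverse) := by
    refine PT.reverse.comp (PT.iterate (f := fun n q => min q.length n :: q) (s := fun _ => [])
      (g := fun n => (n, ())) PT.self (by fun_prop) (by fun_prop) (by fun_prop) fun n q => ?_)
    simp
    omega
  refine this.congr fun n => ?_
  have h : ∀ k ≤ n, (fun q : List ℕ => min q.length n :: q)^[k] [] = (List.range k).reverse := by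
    intro k hk
    induction k with
    | zero => rfl
    | succ k ih =>
      rw [Function.iterate_succ_apply', ih (by omega), List.range_succ]
      simp
      omega
  rw [h n le_rfl, List.reverse_reverse]

@[fun_prop]
theorem PT.drop {i : α → ℕ} {l : α → List β} (hi : PT i) (hl : PT l) :
    PT (fun a => (l a).drop (i a)) := by
  refine (PT.iterate (f := fun _ b => b.tail) (g := fun _ => 1) hi hl (by fun_prop) (by fun_prop)
    (fun _ acc => (sz_sublist (List.tail_sublist acc)).trans (by simp))).congr fun a => ?_
  generalize i a = k
  induction k with
  | zero => rfl
  | succ k ih => rw [Function.iterate_succ_apply', ← ih, List.tail_drop]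

@[fun_prop]
theorem PT.take {i : α → ℕ} {l : α → List β} (hi : PT i) (hl : PT l) :
    PT (fun a => (l a).take (i a)) := by
  have : PT (fun a => ((l a).reverse.drop ((l a).length - i a)).reverse) := by fun_prop
  refine this.congr fun a => ?_
  rw [List.drop_reverse, List.reverse_reverse]
  rcases le_total (i a) (l a).length with h | h
  · congr 1
    omega
  · rw [List.take_of_length_le h, Nat.sub_eq_zero_of_le h, Nat.sub_zero,
      List.take_of_length_le le_rfl]

@[fun_prop]
theorem PT.getD {i : α → ℕ} {l : α → List β} {d : α → β} (hi : PT i) (hl : PT l) (hd : PT d) :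
    PT (fun a => (l a).getD (i a) (d a)) := by
  have : PT (fun a => ((l a).drop (i a)).headD (d a)) := by fun_prop
  exact this.congr fun a => by simp [List.headD_eq_head?_getD]

@[fun_prop]
theorem PT.ne {m n : α → ℕ} (hm : PT m) (hn : PT n) : PT (fun a => m a ≠ n a) :=
  (hm.nat_eq hn).not

@[fun_prop]
theorem PT.nat_mem {m : α → ℕ} {l : α → List ℕ} (hm : PT m) (hl : PT l) :
    PT (fun a => m a ∈ l a) := by
  have : PT (fun a => ∃ b ∈ l a, b = m a) := by fun_prop
  exact this.congr fun a => by simp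

/-- Quotients and logarithms are computed by counting the candidates that satisfy a monotone
condition; this evaluates the count. -/
theorem length_filter_lt_range (k m : ℕ) :
    ((List.range m).filter (fun i => decide (i < k))).length = min k m := by
  induction m with
  | zero => simp
  | succ m ih =>
    rw [List.range_succ, List.filter_append, List.length_append, ih]
    by_cases h : m < k
    · simp [h]
      omega
    · simp [h]
      omega

@[fun_prop]
theorem PT.div {m n : α → ℕ} (hm : PT m) (hn : PT n) : PT (fun a => m a / n a) := by
  have : PT (fun a => if n a = 0 then 0 else
      ((List.range (m a)).filter (fun q => (q + 1) * n a ≤ m a)).length) := by fun_prop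
  refine this.congr fun a => ?_
  split_ifs with h
  · simp [h]
  · have h' : ∀ q, (q + 1) * n a ≤ m a ↔ q < m a / n a := fun q => by
      rw [← Nat.le_div_iff_mul_le (Nat.pos_of_ne_zero h)]
      rfl
    simp only [h', length_filter_lt_range]
    exact (min_eq_left (Nat.div_le_self _ _)).symm

@[fun_prop]
theorem PT.mod {m n : α → ℕ} (hm : PT m) (hn : PT n) : PT (fun a => m a % n a) := by
  have : PT (fun a => m a - n a * (m a / n a)) := by fun_prop
  exact this.congr fun a => (Nat.sub_eq_of_eq_add' (Nat.div_add_mod _ _).symm).symm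

@[fun_prop]
theorem PT.pow_const {m : α → ℕ} (e : ℕ) (hm : PT m) : PT (fun a => m a ^ e) := by
  induction e with
  | zero => simpa using PT.const 1
  | succ e ih => exact (ih.mul hm).congr fun a => pow_succ _ _

/-! ### Powers of two, logarithms, binary digits and primes -/

/-- The power `2 ^ j`, truncated at `c`. -/
def cappedPow (c j : ℕ) : ℕ := min (2 ^ j) c

-- Numbers are unary, so `2 ^ j` itself would be exponentially large. Truncation is compatible with
-- doubling, hence it may be done after every step.
@[fun_prop]
theorem PT.cappedPow {c j : α → ℕ} (hc : PT c) (hj : PT j) :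
    PT (fun a => cappedPow (c a) (j a)) := by
  have : PT (fun a => (fun b => min (2 * b) (c a))^[j a] (min 1 (c a))) :=
    PT.iterate (f := fun a b => min (2 * b) (c a)) (g := c) hj (by fun_prop) (by fun_prop) hc
      (fun _ _ => by simp; omega)
  refine this.congr fun a => ?_
  generalize j a = k
  induction k with
  | zero => rfl
  | succ k ih =>
    rw [Function.iterate_succ_apply', ← ih, DocExchange.cappedPow, DocExchange.cappedPow, pow_succ]
    omega

@[fun_prop]
theorem PT.log {m : α → ℕ} (hm : PT m) : PT (fun a => Nat.log 2 (m a)) := by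
  have : PT (fun a => ((List.range (m a)).filter
      (fun j => DocExchange.cappedPow (m a + 1) (j + 1) ≤ m a)).length) := by fun_prop
  refine this.congr fun a => ?_
  rcases Nat.eq_zero_or_pos (m a) with h | h
  · simp [h]
  have h' : ∀ j, DocExchange.cappedPow (m a + 1) (j + 1) ≤ m a ↔ j < Nat.log 2 (m a) := fun j => by
    rw [← Nat.add_one_le_iff, Nat.le_log_iff_pow_le (by norm_num) h.ne', DocExchange.cappedPow]
    omega
  simp only [h', length_filter_lt_range]
  exact (min_eq_left (Nat.log_le_self _ _)).symm

@[fun_prop]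
theorem PT.testBit {m j : α → ℕ} (hm : PT m) (hj : PT j) :
    PT (fun a => (m a).testBit (j a)) := by
  -- Truncating the power at `m + 1` does no harm: from there on the quotient is `0` with or without
  -- the truncation.
  have : PT (fun a => decide (m a / DocExchange.cappedPow (m a + 1) (j a) % 2 = 1)) := by fun_prop
  refine this.congr fun a => ?_
  rw [Nat.testBit_eq_decide_div_mod_eq, DocExchange.cappedPow]
  rcases le_total (2 ^ j a) (m a + 1) with h | h
  · rw [min_eq_left h]
  · rw [min_eq_right h, Nat.div_eq_of_lt (by omega)]
    rw [Nat.div_eq_of_lt (by omega)]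

theorem sz_append (l l' : List α) : sz (l ++ l') + 1 = sz l + sz l' := by
  induction l with
  | nil => simp; omega
  | cons a l ih => simp; omega

@[fun_prop]
theorem PT.flatten {l : α → List (List β)} (hl : PT l) : PT (fun a => (l a).flatten) := by
  have : PT (fun a => (l a).foldl (fun acc b => acc ++ b) []) :=
    PT.foldl (f := fun _ acc b => acc ++ b) (g := fun _ b => b) hl (PT.const _) (by fun_prop)
      (by fun_prop) (fun c acc a _ => by have := sz_append acc a; omega)
  refine this.congr fun a => ?_
  have : ∀ (m : List (List β)) acc, m.foldl (fun acc b => acc ++ b) acc = acc ++ m.flatten := by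
    intro m
    induction m with
    | nil => simp
    | cons b m ih => intro acc; simp [ih]
  simp [this]

@[fun_prop]
theorem PT.sum {l : α → List ℕ} (hl : PT l) : PT (fun a => (l a).sum) := by
  have : PT (fun a => (l a).foldl (fun acc b => acc + b) 0) :=
    PT.foldl (f := fun _ acc b => acc + b) (g := fun _ b => b) hl (PT.const _) (by fun_prop)
      (by fun_prop) (fun c acc a _ => by simp; omega)
  refine this.congr fun a => ?_
  rw [List.sum_eq_foldl]

@[fun_prop]
theorem PT.bits_eq {l l' : α → List Bool} (hl : PT l) (hl' : PT l') : PT (fun a => l a = l' a) := by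
  have : PT (fun a => (l a).length = (l' a).length ∧ ¬ ∃ i ∈ List.range (l a).length,
      ((l a).getD i false = true ∧ ¬ (l' a).getD i false = true) ∨
      (¬ (l a).getD i false = true ∧ (l' a).getD i false = true)) := by fun_prop
  refine this.congr fun a => propext ⟨fun h => ⟨by rw [h], by rintro ⟨i, -, h'⟩; rw [h] at h'; tauto⟩,
    fun ⟨h, h'⟩ => List.ext_getElem h fun i hi hi' => ?_⟩
  by_contra hne
  refine h' ⟨i, List.mem_range.2 hi, ?_⟩
  rw [List.getD_eq_getElem _ _ hi, List.getD_eq_getElem _ _ hi']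
  revert hne
  cases (l a)[i] <;> cases (l' a)[i] <;> simp

theorem sz_map_le_sz_map {ι : Type} {l : List ι} {f : ι → α} {g : ι → β}
    (h : ∀ i ∈ l, sz (f i) ≤ sz (g i)) : sz (l.map f) ≤ sz (l.map g) := by
  induction l with
  | nil => simp
  | cons a l ih =>
    have h1 := ih fun i hi => h i (List.mem_cons_of_mem _ hi)
    have h2 := h a (by simp)
    simp
    omega

theorem enc_eq_ofBits (l : List Bool) : enc l = Data.ofBits l := by
  induction l with
  | nil => rfl
  | cons b l ih => rw [enc_list_cons, ih]; rfl

@[fun_prop]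
theorem PT.prime {m : α → ℕ} (hm : PT m) : PT (fun a => (m a).Prime) := by
  have : PT (fun a => 2 ≤ m a ∧ ¬ ∃ b ∈ List.range (m a), ∃ c ∈ List.range (m a), b * c = m a) := by
    fun_prop
  refine this.congr fun a => propext ?_
  rw [Nat.prime_def_lt]
  refine and_congr_right fun h2 => ⟨?_, fun h b hb hdvd => ?_⟩
  · rintro h ⟨b, hb, c, hc, hbc⟩
    rw [List.mem_range] at hb hc
    have := h b hb ⟨c, hbc.symm⟩
    simp [this] at hbc
    omega
  · obtain ⟨c, hc⟩ := hdvd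
    by_contra hne
    refine h ⟨b, List.mem_range.2 hb, c, List.mem_range.2 ?_, hc.symm⟩
    have hb0 : b ≠ 0 := by rintro rfl; simp at hc; omega
    have hc0 : 0 < c := Nat.pos_of_ne_zero (by rintro rfl; simp at hc; omega)
    rw [hc]
    exact (Nat.lt_mul_iff_one_lt_left hc0).2 (by omega)

end

end DocExchange

namespace DocExchange

open Enc

/-! ### Locally consistent sampling of positions -/

/-- The number of binary digits of `n`. -/
def lg (n : ℕ) : ℕ := Nat.log 2 n + 1

/-- The last `w` binary digits of `m`, least significant digit first. -/
def bits (w m : ℕ) : List Bool := (List.range w).map (fun j => m.testBit j)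

/-- The entry of a bit string at a position: `1` or `2`, and `0` beyond the end. -/
def symbolAt (l : List Bool) (i : ℕ) : ℕ :=
  if i < l.length then if l.getD i false = true then 2 else 1 else 0

/-- The first position where two bit strings differ. -/
def firstDiff (l l' : List Bool) : ℕ :=
  ((List.range (l.length + 1)).filter (fun i => symbolAt l i ≠ symbolAt l' i)).headD 0

/-- One step of deterministic coin tossing: the first position where `l` differs from `l'` together
with the entry of `l` there. -/
def coinToss (l l' : List Bool) : ℕ :=
  3 * firstDiff l l' + symbolAt l (firstDiff l l')

/-- The length of the colours after one step of coin tossing, when the initial colours have `3 * L`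
bits. -/
def width₁ (L : ℕ) : ℕ := Nat.log 2 (9 * L + 3) + 1

/-- The length of the colours after two steps of coin tossing. -/
def width₂ (L : ℕ) : ℕ := Nat.log 2 (3 * width₁ L + 3) + 1

/-- The number of colours after three steps of coin tossing. -/
def numColours (L : ℕ) : ℕ := 3 * width₂ L + 3

/-- The first element of `S` to the right of `i` at distance less than `2 * D`, by default `i`. -/
def nextIn (S : List ℕ) (D i : ℕ) : ℕ :=
  i + ((List.range (2 * D)).filter (fun e => 0 < e ∧ i + e ∈ S)).headD 0

/-- The initial colour of a position: the window that starts there. -/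
def colour₀ (L : ℕ) (x : List Bool) (i : ℕ) : List Bool := (x.drop i).take (3 * L)

/-- The colour of the position `i` after one step of coin tossing along `nextIn S D`. -/
def colour₁ (L : ℕ) (x : List Bool) (S : List ℕ) (D i : ℕ) : List Bool :=
  bits (width₁ L) (coinToss (colour₀ L x i) (colour₀ L x (nextIn S D i)))

/-- The colour of the position `i` after two steps of coin tossing. -/
def colour₂ (L : ℕ) (x : List Bool) (S : List ℕ) (D i : ℕ) : List Bool :=
  bits (width₂ L) (coinToss (colour₁ L x S D i) (colour₁ L x S D (nextIn S D i)))

/-- The colour of the position `i` after three steps of coin tossing. -/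
def colour₃ (L : ℕ) (x : List Bool) (S : List ℕ) (D i : ℕ) : ℕ :=
  coinToss (colour₂ L x S D i) (colour₂ L x S D (nextIn S D i))

/-- A position of `T` other than `i` at distance less than `2 * D` from `i` exists. -/
def HasNear (T : List ℕ) (D i : ℕ) : Prop :=
  ∃ j ∈ T, i ≠ j ∧ i < j + 2 * D ∧ j < i + 2 * D

open scoped Classical in
/-- Add to `T` the positions of `S` of colour `c` that are not within distance `2 * D` of `T`. -/
noncomputable def addColour (L : ℕ) (x : List Bool) (S : List ℕ) (D : ℕ) (T : List ℕ) (c : ℕ) : List ℕ :=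
  S.filter (fun i => i ∈ T ∨ (colour₃ L x S D i = c ∧ ¬ HasNear T D i))

/-- The greedy choice of positions of `S` at mutual distances at least `2 * D`. -/
noncomputable def thin (L : ℕ) (x : List Bool) (S : List ℕ) (D : ℕ) : List ℕ :=
  (List.range (numColours L)).foldl (addColour L x S D) []

/-- Positions of `x` at mutual distances at least `2 ^ q`. -/
noncomputable def level (L : ℕ) (x : List Bool) (q : ℕ) : List ℕ :=
  (List.range q).foldl (fun S j => thin L x S (cappedPow L j)) (List.range x.length)

/-- The final distance of the sampled positions. -/
def dist (L : ℕ) : ℕ := cappedPow L (Nat.log 2 L)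

/-- The positions that are sampled in `x`. -/
noncomputable def sample (L : ℕ) (x : List Bool) : List ℕ :=
  (level L x (Nat.log 2 L)).filter
    (fun i => ¬ ∃ j ∈ level L x (Nat.log 2 L), i < j ∧ j < i + dist L)

/-- The long window at a position. -/
def window (L : ℕ) (x : List Bool) (s : ℕ) : List Bool := (x.drop s).take (8 * L)

/-! ### Codes and syndromes -/

/-- The number whose binary digits are `v` followed by a leading one, truncated at `N`. -/
def code (N : ℕ) (v : List Bool) : ℕ := v.foldr (fun b a => min (2 * a + b.toNat) N) 1

/-- The inverse of `code`. -/
def decode (m : ℕ) : List Bool := bits (Nat.log 2 m) m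

/-- A bound on the codes of the windows. -/
def codeBound (n : ℕ) : ℕ := 2 * (2 * n) ^ 8

/-- One less than a prime modulus beyond all codes. -/
def modPred (n : ℕ) : ℕ :=
  ((List.range (2 * codeBound n + 1)).filter (fun p => codeBound n < p ∧ p.Prime)).headD 0 - 1

/-- The number of binary digits of a residue. -/
def residueWidth (n : ℕ) : ℕ := 8 * lg n + 11

/-- The codes of the windows of `y` at the sampled positions, for the parameters of length `n`. -/
noncomputable def codeSet (n : ℕ) (y : List Bool) : List ℕ :=
  (List.range (modPred n + 1)).filter
    (fun m => ∃ s ∈ sample (lg n) y, code (codeBound n) (window (lg n) y s) = m)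

/-- The power `v ^ j` modulo `P + 1`. -/
def powMod (P v j : ℕ) : ℕ := v ^ j % (P + 1)

/-- The first `N` power sums modulo `P + 1`. -/
def powerSums (P N : ℕ) (A : List ℕ) : List ℕ :=
  (List.range N).map (fun j => (A.map (fun v => powMod P v j)).sum % (P + 1))

/-- The number of windows that block edit errors can change. -/
def errorBound (n k t : ℕ) : ℕ :=
  k * (64 * numColours (lg n) + 600) + 2 * (t / dist (lg n))

/-- Alice's message. -/
noncomputable def message (n k t : ℕ) (x : List Bool) : List Bool :=
  ((powerSums (modPred n) (2 * errorBound n k t) (codeSet n x)).map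
    (fun m => bits (residueWidth n) m)).flatten ++ x.take (8 * lg n)

/-- The power sums in Alice's message. -/
def receivedSums (n N : ℕ) (msg : List Bool) : List ℕ :=
  (List.range N).map (fun i => ((List.range (modPred n + 1)).filter
    (fun m => bits (residueWidth n) m =
      (msg.drop (i * residueWidth n)).take (residueWidth n))).headD 0)

/-- Entrywise difference modulo `P + 1`. -/
def subMod (P N : ℕ) (u v : List ℕ) : List ℕ :=
  (List.range N).map (fun i => (u.getD i 0 + (P + 1) - v.getD i 0) % (P + 1))

/-! ### Linear algebra and decoding -/

/-- The inner product of the first `N` entries modulo `P + 1`. -/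
def dot (P N : ℕ) (u v : List ℕ) : ℕ :=
  ((List.range N).map (fun i => u.getD i 0 * v.getD i 0)).sum % (P + 1)

/-- The `r`-th vector of `b`, made orthogonal to `row` with the help of `c`. -/
def eliminate (P N : ℕ) (row : List ℕ) (b : List (List ℕ)) (c : List ℕ) (r : ℕ) : List ℕ :=
  (List.range N).map (fun i => (dot P N c row * (b.getD r []).getD i 0 +
    (P + 1 - dot P N (b.getD r []) row) * c.getD i 0) % (P + 1))

/-- From `N` vectors that span a space, make `N` vectors that span the subspace orthogonal to
`row`. -/
def orthStep (P N : ℕ) (b : List (List ℕ)) (row : List ℕ) : List (List ℕ) :=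
  if b.filter (fun c => dot P N c row ≠ 0) = [] then b else
    (List.range N).map
      (fun r => eliminate P N row b ((b.filter (fun c => dot P N c row ≠ 0)).headD []) r)

/-- The standard basis. -/
def unitVectors (N : ℕ) : List (List ℕ) :=
  (List.range N).map (fun j => (List.range N).map (fun i => if i = j then 1 else 0))

/-- Vectors that span the space of the recurrences of length `d` of the sequence `σ`. -/
def recurrences (P d : ℕ) (σ : List ℕ) : List (List ℕ) :=
  (List.range d).foldl (fun b j => orthStep P (d + 1) b (σ.drop j)) (unitVectors (d + 1))

/-- The numbers at which all recurrences vanish. -/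
def IsCommonRoot (P d : ℕ) (b : List (List ℕ)) (m : ℕ) : Prop :=
  ¬ ∃ c ∈ b, dot P (d + 1) c ((List.range (d + 1)).map (fun i => powMod P m i)) ≠ 0

open scoped Classical in
/-- The set `A`, corrected at all common roots. -/
noncomputable def correct (P d : ℕ) (b : List (List ℕ)) (A : List ℕ) : List ℕ :=
  (List.range (P + 1)).filter
    (fun m => (m ∈ A ∧ ¬ IsCommonRoot P d b m) ∨ (¬ m ∈ A ∧ IsCommonRoot P d b m))

/-- The string `v` has the window `u` at position `i`, followed by a further symbol. -/
def HasAt (B : ℕ) (u v : List Bool) (i : ℕ) : Prop :=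
  (v.drop i).take B = u ∧ i + B < v.length

open scoped Classical in
/-- Append to `z` the symbol that follows the last `B` symbols of `z` in a string of `V`. -/
noncomputable def extend (B n : ℕ) (V : List (List Bool)) (z : List Bool) : List Bool :=
  if z.length < n then
    let u := z.drop (z.length - B)
    let v := (V.filter (fun v => ∃ i ∈ List.range v.length, HasAt B u v i)).headD []
    z ++ [v.getD (((List.range v.length).filter (fun i => HasAt B u v i)).headD 0 + B) false]
  else z

/-- Bob's reconstruction of the codes of the windows of Alice's string. -/
noncomputable def recoveredCodes (n d : ℕ) (msg y : List Bool) : List ℕ :=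
  correct (modPred n) d
    (recurrences (modPred n) d (subMod (modPred n) (2 * d) (receivedSums n (2 * d) msg)
      (powerSums (modPred n) (2 * d) (codeSet n y)))) (codeSet n y)

/-- Bob's reconstruction of Alice's string. -/
noncomputable def reconstruct (n k t : ℕ) (msg y : List Bool) : List Bool :=
  (extend (3 * lg n) n ((recoveredCodes n (errorBound n k t) msg y).map decode))^[n]
    (msg.drop (2 * errorBound n k t * residueWidth n))

/-! ### All of this takes polynomial time -/

section

variable {α : Type} [Enc α] {L N n k t d P i j D q r w m : α → ℕ} {S T A u v : α → List ℕ}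
  {x y l l' msg z : α → List Bool} {b : α → List (List ℕ)} {V : α → List (List Bool)}

@[fun_prop]
theorem PT.lg (hn : PT n) : PT (fun a => lg (n a)) := by unfold DocExchange.lg; fun_prop

@[fun_prop]
theorem PT.bits (hw : PT w) (hm : PT m) : PT (fun a => bits (w a) (m a)) := by
  unfold DocExchange.bits; fun_prop

@[fun_prop]
theorem PT.symbolAt (hl : PT l) (hi : PT i) : PT (fun a => symbolAt (l a) (i a)) := by
  unfold DocExchange.symbolAt; fun_prop

@[fun_prop]
theorem PT.firstDiff (hl : PT l) (hl' : PT l') : PT (fun a => firstDiff (l a) (l' a)) := by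
  unfold DocExchange.firstDiff; fun_prop

@[fun_prop]
theorem PT.coinToss (hl : PT l) (hl' : PT l') : PT (fun a => coinToss (l a) (l' a)) := by
  unfold DocExchange.coinToss; fun_prop

@[fun_prop]
theorem PT.width₁ (hL : PT L) : PT (fun a => width₁ (L a)) := by
  unfold DocExchange.width₁; fun_prop

@[fun_prop]
theorem PT.width₂ (hL : PT L) : PT (fun a => width₂ (L a)) := by
  unfold DocExchange.width₂; fun_prop

@[fun_prop]
theorem PT.numColours (hL : PT L) : PT (fun a => numColours (L a)) := by
  unfold DocExchange.numColours; fun_prop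

@[fun_prop]
theorem PT.nextIn (hS : PT S) (hD : PT D) (hi : PT i) :
    PT (fun a => nextIn (S a) (D a) (i a)) := by
  unfold DocExchange.nextIn; fun_prop

@[fun_prop]
theorem PT.colour₀ (hL : PT L) (hx : PT x) (hi : PT i) :
    PT (fun a => colour₀ (L a) (x a) (i a)) := by
  unfold DocExchange.colour₀; fun_prop

@[fun_prop]
theorem PT.colour₁ (hL : PT L) (hx : PT x) (hS : PT S) (hD : PT D) (hi : PT i) :
    PT (fun a => colour₁ (L a) (x a) (S a) (D a) (i a)) := by
  unfold DocExchange.colour₁; fun_prop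

@[fun_prop]
theorem PT.colour₂ (hL : PT L) (hx : PT x) (hS : PT S) (hD : PT D) (hi : PT i) :
    PT (fun a => colour₂ (L a) (x a) (S a) (D a) (i a)) := by
  unfold DocExchange.colour₂; fun_prop

@[fun_prop]
theorem PT.colour₃ (hL : PT L) (hx : PT x) (hS : PT S) (hD : PT D) (hi : PT i) :
    PT (fun a => colour₃ (L a) (x a) (S a) (D a) (i a)) := by
  unfold DocExchange.colour₃; fun_prop

@[fun_prop]
theorem PT.hasNear (hT : PT T) (hD : PT D) (hi : PT i) :
    PT (fun a => HasNear (T a) (D a) (i a)) := by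
  unfold HasNear; fun_prop

@[fun_prop]
theorem PT.addColour (hL : PT L) (hx : PT x) (hS : PT S) (hD : PT D) (hT : PT T) (hi : PT i) :
    PT (fun a => addColour (L a) (x a) (S a) (D a) (T a) (i a)) := by
  unfold DocExchange.addColour
  refine PT.filter hS (PT.decide_prop (PT.or (by fun_prop) (PT.and (PT.nat_eq ?_ (by fun_prop))
    (by fun_prop))))
  exact PT.colour₃ (by fun_prop) (by fun_prop) (by fun_prop) (by fun_prop) (by fun_prop)

/-- A sublist has no larger encoding, so this bounds the accumulator of the loop over the colours.
-/
theorem addColour_sublist (L : ℕ) (x : List Bool) (S : List ℕ) (D : ℕ) (T : List ℕ) (c : ℕ) :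
    (addColour L x S D T c).Sublist S := List.filter_sublist

@[fun_prop]
theorem PT.thin (hL : PT L) (hx : PT x) (hS : PT S) (hD : PT D) :
    PT (fun a => thin (L a) (x a) (S a) (D a)) :=
  PT.foldl (f := fun a T c => DocExchange.addColour (L a) (x a) (S a) (D a) T c)
    (g := fun a _ => S a) (by fun_prop) (by fun_prop) (by fun_prop) (by fun_prop)
    (fun a T c _ => (sz_sublist (addColour_sublist ..)).trans (Nat.le_add_left _ _))

theorem thin_sublist (L : ℕ) (x : List Bool) (S : List ℕ) (D : ℕ) :
    (thin L x S D).Sublist S := by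
  unfold thin
  rw [show numColours L = 3 * width₂ L + 2 + 1 from rfl, List.range_succ, List.foldl_append]
  exact addColour_sublist ..

@[fun_prop]
theorem PT.level (hL : PT L) (hx : PT x) (hq : PT q) :
    PT (fun a => level (L a) (x a) (q a)) :=
  PT.foldl (f := fun a S j => DocExchange.thin (L a) (x a) S (DocExchange.cappedPow (L a) j))
    (g := fun a _ => ()) (by fun_prop) (by fun_prop) (by fun_prop) (by fun_prop)
    (fun a T c _ => (sz_sublist (thin_sublist ..)).trans (Nat.le_add_right _ _))

@[fun_prop]
theorem PT.dist (hL : PT L) : PT (fun a => dist (L a)) := by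
  unfold DocExchange.dist; fun_prop

@[fun_prop]
theorem PT.sample (hL : PT L) (hx : PT x) : PT (fun a => sample (L a) (x a)) := by
  unfold DocExchange.sample; fun_prop

@[fun_prop]
theorem PT.window (hL : PT L) (hx : PT x) (hi : PT i) :
    PT (fun a => window (L a) (x a) (i a)) := by
  unfold DocExchange.window; fun_prop

@[fun_prop]
theorem PT.toNat : PT (fun b : Bool => b.toNat) := by
  have : PT (fun b : Bool => if b = true then 1 else 0) := by fun_prop
  exact this.congr fun b => by cases b <;> rfl

@[fun_prop]
theorem PT.code (hN : PT N) (hl : PT l) : PT (fun a => code (N a) (l a)) := by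
  have : PT (fun a => (l a).reverse.foldl (fun c b => min (2 * c + b.toNat) (N a)) 1) :=
    PT.foldl (f := fun a c (b : Bool) => min (2 * c + b.toNat) (N a)) (g := fun a _ => N a)
      (by fun_prop) (by fun_prop) (by fun_prop) (by fun_prop) (fun a c b _ => by simp; omega)
  exact this.congr fun a => by rw [List.foldl_reverse]; rfl

@[fun_prop]
theorem PT.decode (hm : PT m) : PT (fun a => decode (m a)) := by
  unfold DocExchange.decode; fun_prop

@[fun_prop]
theorem PT.codeBound (hn : PT n) : PT (fun a => codeBound (n a)) := by
  unfold DocExchange.codeBound; fun_prop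

@[fun_prop]
theorem PT.modPred (hn : PT n) : PT (fun a => modPred (n a)) := by
  unfold DocExchange.modPred; fun_prop

@[fun_prop]
theorem PT.residueWidth (hn : PT n) : PT (fun a => residueWidth (n a)) := by
  unfold DocExchange.residueWidth; fun_prop

@[fun_prop]
theorem PT.codeSet (hn : PT n) (hy : PT y) : PT (fun a => codeSet (n a) (y a)) := by
  unfold DocExchange.codeSet; fun_prop

@[fun_prop]
theorem PT.powMod (hP : PT P) (hm : PT m) (hj : PT j) :
    PT (fun a => powMod (P a) (m a) (j a)) := by
  have : PT (fun a => (fun c => c * m a % (P a + 1))^[j a] (1 % (P a + 1))) :=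
    PT.iterate (f := fun a c => c * m a % (P a + 1)) (g := P) hj (by fun_prop) (by fun_prop)
      (by fun_prop) (fun a c => by
        have := Nat.mod_lt (c * m a) (Nat.add_one_pos (P a))
        simp only [sz_nat]
        omega)
  refine this.congr fun a => ?_
  generalize j a = k
  unfold DocExchange.powMod
  induction k with
  | zero => rfl
  | succ k ih => rw [Function.iterate_succ_apply', ← ih, pow_succ, Nat.mod_mul_mod]

@[fun_prop]
theorem PT.powerSums (hP : PT P) (hN : PT N) (hA : PT A) :
    PT (fun a => powerSums (P a) (N a) (A a)) := by
  unfold DocExchange.powerSums; fun_prop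

@[fun_prop]
theorem PT.errorBound (hn : PT n) (hk : PT k) (ht : PT t) :
    PT (fun a => errorBound (n a) (k a) (t a)) := by
  unfold DocExchange.errorBound; fun_prop

@[fun_prop]
theorem PT.message (hn : PT n) (hk : PT k) (ht : PT t) (hx : PT x) :
    PT (fun a => message (n a) (k a) (t a) (x a)) := by
  unfold DocExchange.message; fun_prop

@[fun_prop]
theorem PT.receivedSums (hn : PT n) (hN : PT N) (hmsg : PT msg) :
    PT (fun a => receivedSums (n a) (N a) (msg a)) := by
  unfold DocExchange.receivedSums; fun_prop

@[fun_prop]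
theorem PT.subMod (hP : PT P) (hN : PT N) (hu : PT u) (hv : PT v) :
    PT (fun a => subMod (P a) (N a) (u a) (v a)) := by
  unfold DocExchange.subMod; fun_prop

@[fun_prop]
theorem PT.dot (hP : PT P) (hN : PT N) (hu : PT u) (hv : PT v) :
    PT (fun a => dot (P a) (N a) (u a) (v a)) := by
  unfold DocExchange.dot; fun_prop

@[fun_prop]
theorem PT.eliminate (hP : PT P) (hN : PT N) (hu : PT u) (hb : PT b) (hv : PT v) (hr : PT r) :
    PT (fun a => eliminate (P a) (N a) (u a) (b a) (v a) (r a)) := by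
  unfold DocExchange.eliminate; fun_prop

@[fun_prop]
theorem PT.orthStep (hP : PT P) (hN : PT N) (hb : PT b) (hu : PT u) :
    PT (fun a => orthStep (P a) (N a) (b a) (u a)) := by
  unfold DocExchange.orthStep; fun_prop

@[fun_prop]
theorem PT.unitVectors (hN : PT N) : PT (fun a => unitVectors (N a)) := by
  unfold DocExchange.unitVectors; fun_prop

/-- Entries are reduced modulo `P + 1` in every step, so the matrix stays within a fixed size
however many rows are processed; without the reduction the entries could grow exponentially. -/
theorem sz_orthStep_le (P N : ℕ) (b : List (List ℕ)) (row : List ℕ) :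
    sz (orthStep P N b row) ≤
      sz b + sz ((List.range N).map (fun _ => (List.range N).map (fun _ => P))) := by
  unfold orthStep
  split
  · omega
  · refine le_add_left (sz_map_le_sz_map fun r _ => sz_map_le_sz_map fun i _ => ?_)
    simp only [sz_nat]
    exact Nat.add_le_add_right (Nat.mul_le_mul_left 2
      (Nat.le_of_lt_succ (Nat.mod_lt _ (Nat.add_one_pos P)))) 1

@[fun_prop]
theorem PT.recurrences (hP : PT P) (hd : PT d) (hu : PT u) :
    PT (fun a => recurrences (P a) (d a) (u a)) :=
  PT.foldl (f := fun a b j => DocExchange.orthStep (P a) (d a + 1) b ((u a).drop j))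
    (g := fun a _ => (List.range (d a + 1)).map
      (fun _ => (List.range (d a + 1)).map (fun _ => P a)))
    (by fun_prop) (by fun_prop) (by fun_prop) (by fun_prop) (fun a b c _ => sz_orthStep_le ..)

@[fun_prop]
theorem PT.isCommonRoot (hP : PT P) (hd : PT d) (hb : PT b) (hm : PT m) :
    PT (fun a => IsCommonRoot (P a) (d a) (b a) (m a)) := by
  unfold IsCommonRoot; fun_prop

@[fun_prop]
theorem PT.correct (hP : PT P) (hd : PT d) (hb : PT b) (hA : PT A) :
    PT (fun a => correct (P a) (d a) (b a) (A a)) := by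
  unfold DocExchange.correct; fun_prop

@[fun_prop]
theorem PT.hasAt (hL : PT L) (hl : PT l) (hl' : PT l') (hi : PT i) :
    PT (fun a => HasAt (L a) (l a) (l' a) (i a)) := by
  unfold HasAt; fun_prop

@[fun_prop]
theorem PT.extend (hL : PT L) (hn : PT n) (hV : PT V) (hz : PT z) :
    PT (fun a => extend (L a) (n a) (V a) (z a)) := by
  unfold DocExchange.extend; fun_prop

theorem sz_append_singleton_le (z : List Bool) (b : Bool) : sz (z ++ [b]) ≤ sz z + sz [true] := by
  have h := sz_append z [b]
  have h1 : sz [b] ≤ sz [true] := by cases b <;> decide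
  omega

theorem sz_extend_le (B n : ℕ) (V : List (List Bool)) (z : List Bool) :
    sz (extend B n V z) ≤ sz z + sz [true] := by
  unfold extend
  split
  · exact sz_append_singleton_le ..
  · omega

@[fun_prop]
theorem PT.recoveredCodes (hn : PT n) (hd : PT d) (hmsg : PT msg) (hy : PT y) :
    PT (fun a => recoveredCodes (n a) (d a) (msg a) (y a)) := by
  unfold DocExchange.recoveredCodes; fun_prop

@[fun_prop]
theorem PT.reconstruct (hn : PT n) (hk : PT k) (ht : PT t) (hmsg : PT msg) (hy : PT y) :
    PT (fun a => reconstruct (n a) (k a) (t a) (msg a) (y a)) :=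
  PT.iterate (f := fun a z => DocExchange.extend (3 * DocExchange.lg (n a)) (n a)
    ((DocExchange.recoveredCodes (n a) (DocExchange.errorBound (n a) (k a) (t a))
      (msg a) (y a)).map DocExchange.decode) z) (g := fun _ => [true])
    (by fun_prop) (by fun_prop) (by fun_prop) (by fun_prop) (fun a z => sz_extend_le ..)

end

end DocExchange

namespace DocExchange

/-! ### Coin tossing -/

theorem headD_mem {α : Type} {l : List α} {d : α} (h : l ≠ []) : l.headD d ∈ l := by
  cases l with
  | nil => exact absurd rfl h
  | cons a l => simp

theorem headD_mem_or {α : Type} (l : List α) (d : α) : l.headD d ∈ l ∨ l.headD d = d := by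
  cases l <;> simp

theorem bits_injOn {w m m' : ℕ} (hm : m < 2 ^ w) (hm' : m' < 2 ^ w) (h : bits w m = bits w m') :
    m = m' := by
  refine Nat.eq_of_testBit_eq fun j => ?_
  rcases lt_or_ge j w with hj | hj
  · have := congrArg (fun l => l.getD j false) h
    simpa [bits, hj] using this
  · rw [Nat.testBit_eq_false_of_lt (hm.trans_le (Nat.pow_le_pow_right (by norm_num) hj)),
      Nat.testBit_eq_false_of_lt (hm'.trans_le (Nat.pow_le_pow_right (by norm_num) hj))]

@[simp] theorem length_bits (w m : ℕ) : (bits w m).length = w := by simp [bits]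

theorem symbolAt_lt (l : List Bool) (i : ℕ) : symbolAt l i < 3 := by
  unfold symbolAt
  split_ifs <;> omega

theorem symbolAt_eq_zero {l : List Bool} {i : ℕ} : symbolAt l i = 0 ↔ l.length ≤ i := by
  unfold symbolAt
  split_ifs <;> simp <;> omega

/-- The value `0` beyond the end lets `symbolAt` record the length too, so that also windows cut
short by the end of the string can be compared. -/
theorem eq_of_symbolAt_eq {l l' : List Bool} (h : ∀ i, symbolAt l i = symbolAt l' i) : l = l' := by
  have hlen : l.length = l'.length := by
    apply le_antisymm
    · rw [← symbolAt_eq_zero, h, symbolAt_eq_zero]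
    · rw [← symbolAt_eq_zero, ← h, symbolAt_eq_zero]
  refine List.ext_getElem hlen fun i hi hi' => ?_
  have := h i
  simp only [symbolAt, hi, hi', if_true, List.getD_eq_getElem] at this
  cases h1 : l[i] <;> cases h2 : l'[i] <;> simp_all

theorem firstDiff_spec {l l' : List Bool} (h : l ≠ l') :
    symbolAt l (firstDiff l l') ≠ symbolAt l' (firstDiff l l') := by
  obtain ⟨i, hi⟩ : ∃ i, symbolAt l i ≠ symbolAt l' i := by
    by_contra hc
    push Not at hc
    exact h (eq_of_symbolAt_eq hc)
  -- If the strings differ beyond the end of `l`, then `l'` is longer and they already differ at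
  -- position `l.length`, which is inside the range searched.
  have hex : ∃ i < l.length + 1, symbolAt l i ≠ symbolAt l' i := by
    rcases lt_or_ge i (l.length + 1) with h1 | h1
    · exact ⟨i, h1, hi⟩
    · refine ⟨l.length, by omega, ?_⟩
      rw [symbolAt_eq_zero.2 le_rfl]
      intro h0
      have := symbolAt_eq_zero.1 h0.symm
      exact hi (by rw [symbolAt_eq_zero.2 (by omega), symbolAt_eq_zero.2 (by omega)])
  obtain ⟨i, h1, h2⟩ := hex
  have hmem : i ∈ (List.range (l.length + 1)).filter (fun i => symbolAt l i ≠ symbolAt l' i) := by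
    simp [h2, List.mem_filter]
    omega
  have := headD_mem (d := 0) (List.ne_nil_of_mem hmem)
  exact of_decide_eq_true (List.mem_filter.1 this).2

theorem firstDiff_le (l l' : List Bool) : firstDiff l l' ≤ l.length := by
  rcases headD_mem_or ((List.range (l.length + 1)).filter
    (fun i => symbolAt l i ≠ symbolAt l' i)) 0 with h | h
  · have := List.mem_range.1 (List.mem_filter.1 h).1
    unfold firstDiff
    omega
  · unfold firstDiff
    omega

theorem coinToss_lt (l l' : List Bool) : coinToss l l' < 3 * l.length + 3 := by
  have := firstDiff_le l l'
  have := symbolAt_lt l (firstDiff l l')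
  unfold coinToss
  omega

/-- Equal results would mean the same position and the same symbol there, but that position was
chosen because `l` and `l'` differ at it. As `l''` is arbitrary, the last point of a path needs no
special treatment. -/
theorem coinToss_ne {l l' : List Bool} (h : l ≠ l') (l'' : List Bool) :
    coinToss l l' ≠ coinToss l' l'' := by
  intro heq
  have h1 := symbolAt_lt l (firstDiff l l')
  have h2 := symbolAt_lt l' (firstDiff l' l'')
  unfold coinToss at heq
  have h3 : firstDiff l l' = firstDiff l' l'' := by omega
  have h4 := firstDiff_spec h
  rw [← h3] at heq
  omega

theorem lt_two_pow_width₁ {L : ℕ} {l l' : List Bool} (h : l.length ≤ 3 * L) :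
    coinToss l l' < 2 ^ width₁ L :=
  (coinToss_lt l l').trans_le ((by omega : 3 * l.length + 3 ≤ 9 * L + 3).trans
    (Nat.lt_pow_succ_log_self (by norm_num) _).le)

theorem lt_two_pow_width₂ {L : ℕ} {l l' : List Bool} (h : l.length = width₁ L) :
    coinToss l l' < 2 ^ width₂ L :=
  (coinToss_lt l l').trans_le ((by omega : 3 * l.length + 3 ≤ 3 * width₁ L + 3).trans
    (Nat.lt_pow_succ_log_self (by norm_num) _).le)

/-! ### Sampling a string with distinct windows -/

/-- The elements of `S` have mutual distances at least `D`. -/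
def Separated (D : ℕ) (S : List ℕ) : Prop := ∀ i ∈ S, ∀ j ∈ S, i < j → i + D ≤ j

/-- Each interval of length `G` in `{0, …, n - 1}` meets `S`. -/
def Covers (n G : ℕ) (S : List ℕ) : Prop := ∀ i, i + G ≤ n → ∃ s ∈ S, i ≤ s ∧ s < i + G

/-- A third element between `i` and `j` would force their distance up to `2 * D`. So points in
conflict are neighbours: the conflict graph is a union of paths with successor function `nextIn`,
which is what coin tossing needs. -/
theorem nextIn_eq {S : List ℕ} {D i j : ℕ} (hS : Separated D S) (hi : i ∈ S) (hj : j ∈ S)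
    (hij : i < j) (hjD : j < i + 2 * D) : nextIn S D i = j := by
  have hmem : j - i ∈ (List.range (2 * D)).filter (fun e => 0 < e ∧ i + e ∈ S) := by
    simp only [List.mem_filter, List.mem_range, decide_eq_true_eq]
    exact ⟨by omega, by omega, by rwa [Nat.add_sub_cancel' hij.le]⟩
  have h := headD_mem (d := 0) (List.ne_nil_of_mem hmem)
  unfold nextIn
  generalize ((List.range (2 * D)).filter (fun e => 0 < e ∧ i + e ∈ S)).headD 0 = e at *
  simp only [List.mem_filter, List.mem_range, decide_eq_true_eq] at h
  obtain ⟨h1, h2, h3⟩ := h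
  have := hS i hi _ h3 (by omega)
  have := hS i hi j hj hij
  rcases lt_trichotomy (i + e) j with h4 | h4 | h4
  · have := hS _ h3 j hj h4
    omega
  · exact h4
  · have := hS j hj _ h3 h4
    omega

/-- Full windows differ by distinctness; a window that runs over the end of `x` differs from every
earlier one in length. -/
theorem colour₀_ne {L : ℕ} {x : List Bool} (hx : BDistinct (3 * L) x) {i j : ℕ} (hij : i < j)
    (hj : j < x.length) : colour₀ L x i ≠ colour₀ L x j := by
  intro h
  rcases le_or_gt (j + 3 * L) x.length with h1 | h1
  · exact hx i j hij.ne (by omega) h1 h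
  · have := congrArg List.length h
    simp only [colour₀, List.length_take, List.length_drop] at this
    omega

theorem colour₃_ne {L : ℕ} {x : List Bool} {S : List ℕ} {D : ℕ} (hx : BDistinct (3 * L) x)
    (hSx : ∀ i ∈ S, i < x.length) (hS : Separated D S) {i j : ℕ} (hi : i ∈ S) (hj : j ∈ S)
    (hij : i < j) (hjD : j < i + 2 * D) : colour₃ L x S D i ≠ colour₃ L x S D j := by
  have hnext := nextIn_eq hS hi hj hij hjD
  have h₀ := colour₀_ne hx hij (hSx j hj)
  have hlen : ∀ i, (colour₀ L x i).length ≤ 3 * L := fun i => by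
    unfold colour₀
    exact List.length_take_le _ _
  have h₁ : colour₁ L x S D i ≠ colour₁ L x S D j := by
    intro h
    unfold colour₁ at h
    rw [hnext] at h
    exact coinToss_ne h₀ _ (bits_injOn (lt_two_pow_width₁ (hlen i)) (lt_two_pow_width₁ (hlen j)) h)
  have hlen₁ : ∀ i, (colour₁ L x S D i).length = width₁ L := fun i => by simp [colour₁]
  have h₂ : colour₂ L x S D i ≠ colour₂ L x S D j := by
    intro h
    unfold colour₂ at h
    rw [hnext] at h
    exact coinToss_ne h₁ _
      (bits_injOn (lt_two_pow_width₂ (hlen₁ i)) (lt_two_pow_width₂ (hlen₁ j)) h)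
  unfold colour₃
  rw [hnext]
  exact coinToss_ne h₂ _

theorem colour₃_lt (L : ℕ) (x : List Bool) (S : List ℕ) (D i : ℕ) :
    colour₃ L x S D i < numColours L := by
  have := coinToss_lt (colour₂ L x S D i) (colour₂ L x S D (nextIn S D i))
  simpa [colour₂, numColours, colour₃] using this

/-- The greedy choice after the first `c` colours. -/
noncomputable def thinUpTo (L : ℕ) (x : List Bool) (S : List ℕ) (D c : ℕ) : List ℕ :=
  (List.range c).foldl (addColour L x S D) []

theorem thinUpTo_succ (L : ℕ) (x : List Bool) (S : List ℕ) (D c : ℕ) :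
    thinUpTo L x S D (c + 1) = addColour L x S D (thinUpTo L x S D c) c := by
  simp [thinUpTo, List.range_succ]

theorem mem_addColour {L : ℕ} {x : List Bool} {S : List ℕ} {D : ℕ} {T : List ℕ} {c i : ℕ} :
    i ∈ addColour L x S D T c ↔
      i ∈ S ∧ (i ∈ T ∨ (colour₃ L x S D i = c ∧ ¬ HasNear T D i)) := by
  simp [addColour]

theorem thinUpTo_subset (L : ℕ) (x : List Bool) (S : List ℕ) (D c : ℕ) :
    thinUpTo L x S D c ⊆ S := by
  cases c with
  | zero => simp [thinUpTo]
  | succ c =>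
    rw [thinUpTo_succ]
    exact (addColour_sublist ..).subset

theorem thinUpTo_mono (L : ℕ) (x : List Bool) (S : List ℕ) (D : ℕ) {c c' : ℕ} (h : c ≤ c') :
    thinUpTo L x S D c ⊆ thinUpTo L x S D c' := by
  induction h with
  | refl => exact fun _ h => h
  | step _ ih =>
    refine List.Subset.trans ih fun i hi => ?_
    rw [Nat.succ_eq_add_one, thinUpTo_succ, mem_addColour]
    exact ⟨thinUpTo_subset _ _ _ _ _ hi, .inl hi⟩

/-- Points added in different rounds are kept apart by `HasNear`, and points added in the same round
have the same colour, which by `colour₃_ne` conflicting points never have. -/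
theorem separated_thinUpTo {L : ℕ} {x : List Bool} {S : List ℕ} {D : ℕ} (hx : BDistinct (3 * L) x)
    (hSx : ∀ i ∈ S, i < x.length) (hS : Separated D S) (c : ℕ) :
    Separated (2 * D) (thinUpTo L x S D c) := by
  induction c with
  | zero => simp [thinUpTo, Separated]
  | succ c ih =>
    intro i hi j hj hij
    rw [thinUpTo_succ, mem_addColour] at hi hj
    by_contra hlt
    rcases hi with ⟨hiS, hi | ⟨hic, hi⟩⟩ <;> rcases hj with ⟨hjS, hj | ⟨hjc, hj⟩⟩
    · exact hlt (ih i hi j hj hij)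
    · exact hj ⟨i, hi, by omega, by omega, by omega⟩
    · exact hi ⟨j, hj, by omega, by omega, by omega⟩
    · exact colour₃_ne hx hSx hS hiS hjS hij (by omega) (hic.trans hjc.symm)

/-- When the colour of `i` has its turn, `i` is either added or blocked by a point already chosen,
and chosen points are never removed. -/
theorem mem_thin_or_hasNear {L : ℕ} {x : List Bool} {S : List ℕ} {D i : ℕ} (hi : i ∈ S) :
    i ∈ thin L x S D ∨ HasNear (thin L x S D) D i := by
  have hc := colour₃_lt L x S D i
  have hsub := thinUpTo_mono L x S D hc
  rw [Nat.succ_eq_add_one] at hsub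
  by_cases h : HasNear (thinUpTo L x S D (colour₃ L x S D i)) D i
  · obtain ⟨j, hj, h⟩ := h
    exact .inr ⟨j, thinUpTo_mono L x S D hc.le hj, h⟩
  · refine .inl (hsub ?_)
    rw [thinUpTo_succ, mem_addColour]
    exact ⟨hi, .inr ⟨rfl, h⟩⟩

theorem Covers.thin {L n G D : ℕ} {x : List Bool} {S : List ℕ} (hS : Covers n G S) :
    Covers n (G + 4 * D) (thin L x S D) := by
  intro i hi
  -- The search starts `2 * D` further right, because the chosen point may lie up to `2 * D` away on
  -- either side of `s`.
  obtain ⟨s, hs, h1, h2⟩ := hS (i + 2 * D) (by omega)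
  rcases mem_thin_or_hasNear (L := L) (x := x) (D := D) hs with h | ⟨j, hj, h3, h4, h5⟩
  · exact ⟨s, h, by omega, by omega⟩
  · exact ⟨j, hj, by omega, by omega⟩

theorem Covers.mono {n G G' : ℕ} {S : List ℕ} (h : Covers n G S) (hG : G ≤ G') :
    Covers n G' S := fun i hi =>
  let ⟨s, hs, h1, h2⟩ := h i (by omega)
  ⟨s, hs, h1, by omega⟩

theorem level_succ (L : ℕ) (x : List Bool) (q : ℕ) :
    level L x (q + 1) = thin L x (level L x q) (cappedPow L q) := by
  simp [level, List.range_succ]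

theorem level_lt_length (L : ℕ) (x : List Bool) (q : ℕ) : ∀ i ∈ level L x q, i < x.length := by
  induction q with
  | zero => simp [level]
  | succ q ih =>
    intro i hi
    rw [level_succ] at hi
    exact ih i ((thin_sublist ..).subset hi)

theorem cappedPow_eq {L q : ℕ} (hL : L ≠ 0) (hq : q ≤ Nat.log 2 L) : cappedPow L q = 2 ^ q :=
  min_eq_left ((Nat.pow_le_pow_right (by norm_num) hq).trans (Nat.pow_log_le_self 2 hL))

theorem level_spec {L : ℕ} {x : List Bool} (hL : L ≠ 0) (hx : BDistinct (3 * L) x) {q : ℕ}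
    (hq : q ≤ Nat.log 2 L) :
    Separated (2 ^ q) (level L x q) ∧ Covers x.length (4 * 2 ^ q) (level L x q) := by
  -- The gap starts at `1` and grows by `4 * 2 ^ j` in step `j`, which sums to exactly `4 * 2 ^ q -
  -- 3`.
  suffices h : Separated (2 ^ q) (level L x q) ∧ Covers x.length (4 * 2 ^ q - 3) (level L x q) from
    ⟨h.1, h.2.mono (Nat.sub_le _ _)⟩
  induction q with
  | zero =>
    refine ⟨fun i _ j _ hij => by omega, fun i hi => ⟨i, ?_, le_rfl, by omega⟩⟩
    simp [level]
    omega
  | succ q ih =>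
    obtain ⟨h1, h2⟩ := ih (by omega)
    rw [level_succ, cappedPow_eq hL (by omega)]
    constructor
    · rw [pow_succ, mul_comm]
      exact separated_thinUpTo hx (level_lt_length L x q) h1 _
    · refine h2.thin.mono ?_
      have := Nat.one_le_two_pow (n := q)
      rw [pow_succ]
      omega

theorem dist_eq {L : ℕ} (hL : L ≠ 0) : dist L = 2 ^ Nat.log 2 L := cappedPow_eq hL le_rfl

theorem dist_le (L : ℕ) : dist L ≤ L := min_le_right _ _

theorem lt_two_mul_dist {L : ℕ} (hL : L ≠ 0) : L < 2 * dist L := by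
  have := Nat.lt_pow_succ_log_self (b := 2) (by norm_num) L
  rw [dist_eq hL]
  rw [pow_succ] at this
  omega

theorem dist_pos {L : ℕ} (hL : L ≠ 0) : 0 < dist L := by
  have := lt_two_mul_dist hL
  omega

theorem mem_sample {L : ℕ} {x : List Bool} {i : ℕ} :
    i ∈ sample L x ↔ i ∈ level L x (Nat.log 2 L) ∧
      ¬ ∃ j ∈ level L x (Nat.log 2 L), i < j ∧ j < i + dist L := by
  simp [sample]

theorem covers_sample {L : ℕ} {x : List Bool} (hL : L ≠ 0) (hx : BDistinct (3 * L) x) :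
    Covers x.length (4 * L) (sample L x) := by
  obtain ⟨h1, h2⟩ := level_spec hL hx le_rfl
  rw [← dist_eq hL] at h1 h2
  refine Covers.mono (fun i hi => ?_) (Nat.mul_le_mul_left 4 (dist_le L))
  obtain ⟨s, hs, h⟩ := h2 i hi
  -- For distinct `x` the last level is already separated, so the final filter of `sample` removes
  -- nothing.
  refine ⟨s, mem_sample.2 ⟨hs, ?_⟩, h⟩
  rintro ⟨j, hj, h3, h4⟩
  have := h1 s hs j hj h3
  omega

/-- This is forced by the final filter and holds for every string. Corrupted strings need not be
distinct, and then the colourings guarantee nothing, but their samples must be counted as well. -/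
theorem separated_sample (L : ℕ) (x : List Bool) : Separated (dist L) (sample L x) := by
  intro i hi j hj hij
  by_contra h
  exact (mem_sample.1 hi).2 ⟨j, (mem_sample.1 hj).1, hij, by omega⟩

theorem sample_lt_length {L : ℕ} {x : List Bool} {i : ℕ} (hi : i ∈ sample L x) : i < x.length :=
  level_lt_length _ _ _ _ (mem_sample.1 hi).1

end DocExchange

namespace DocExchange

/-! ### The sampling is local -/

/-- The substrings of length `M` of `x` and `y` at the positions `p` and `q` are equal. -/
structure Common (x y : List Bool) (p q M : ℕ) : Prop where
  left : p + M ≤ x.length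
  right : q + M ≤ y.length
  eq : (x.drop p).take M = (y.drop q).take M

/-- The sets `S` and `T` agree on the pieces of length `M` at `p` and `q`, except near the ends. -/
def AgreeOn (p q M r : ℕ) (S T : List ℕ) : Prop :=
  ∀ s, r ≤ s → s + r ≤ M → (p + s ∈ S ↔ q + s ∈ T)

theorem AgreeOn.mono {p q M r r' : ℕ} {S T : List ℕ} (h : AgreeOn p q M r S T) (hr : r ≤ r') :
    AgreeOn p q M r' S T := fun s h1 h2 => h s (by omega) (by omega)

variable {x y : List Bool} {p q M r r' L D s : ℕ} {S T S' T' : List ℕ}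

theorem Common.take_drop (h : Common x y p q M) {l : ℕ} (hs : s + l ≤ M) :
    (x.drop (p + s)).take l = (y.drop (q + s)).take l := by
  have := congrArg (fun z => (z.drop s).take l) h.eq
  simpa [List.drop_take, List.take_take, List.drop_drop, min_eq_left (by omega : l ≤ M - s)]
    using this

theorem AgreeOn.nextIn (h : AgreeOn p q M r S T) (h1 : r + 2 * D ≤ s) (h2 : s + (r + 2 * D) ≤ M) :
    ∃ e < 2 * D + 1, nextIn S D (p + s) = p + (s + e) ∧ nextIn T D (q + s) = q + (s + e) := by
  have hf : (List.range (2 * D)).filter (fun e => 0 < e ∧ p + s + e ∈ S) =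
      (List.range (2 * D)).filter (fun e => 0 < e ∧ q + s + e ∈ T) := by
    refine List.filter_congr fun e he => ?_
    have := List.mem_range.1 he
    have h3 := h (s + e) (by omega) (by omega)
    simp only [add_assoc, h3]
  refine ⟨((List.range (2 * D)).filter (fun e => 0 < e ∧ p + s + e ∈ S)).headD 0, ?_,
    Nat.add_assoc .., ?_⟩
  · rcases headD_mem_or ((List.range (2 * D)).filter (fun e => 0 < e ∧ p + s + e ∈ S)) 0 with h | h
    · have := List.mem_range.1 (List.mem_filter.1 h).1
      omega
    · omega
  · rw [DocExchange.nextIn, hf, add_assoc]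

/-- One round of coin tossing looks at the next point, less than `2 * D` away, and at windows of
length `3 * L`, which fit because `3 * L ≤ r`. Three rounds therefore lose `6 * D`. -/
theorem AgreeOn.colour₁ (hc : Common x y p q M) (h : AgreeOn p q M r S T) (hr : 3 * L ≤ r)
    (h1 : r + 2 * D ≤ s) (h2 : s + (r + 2 * D) ≤ M) :
    colour₁ L x S D (p + s) = colour₁ L y T D (q + s) := by
  obtain ⟨e, he, h3, h4⟩ := h.nextIn h1 h2
  have h5 : ∀ s, s + 3 * L ≤ M → colour₀ L x (p + s) = colour₀ L y (q + s) :=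
    fun s hs => hc.take_drop hs
  rw [DocExchange.colour₁, DocExchange.colour₁, h3, h4, h5 s (by omega), h5 (s + e) (by omega)]

theorem AgreeOn.colour₂ (hc : Common x y p q M) (h : AgreeOn p q M r S T) (hr : 3 * L ≤ r)
    (h1 : r + 4 * D ≤ s) (h2 : s + (r + 4 * D) ≤ M) :
    colour₂ L x S D (p + s) = colour₂ L y T D (q + s) := by
  obtain ⟨e, he, h3, h4⟩ := h.nextIn (D := D) (s := s) (by omega) (by omega)
  rw [DocExchange.colour₂, DocExchange.colour₂, h3, h4, h.colour₁ hc hr (by omega) (by omega),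
    h.colour₁ hc hr (by omega) (by omega)]

theorem AgreeOn.colour₃ (hc : Common x y p q M) (h : AgreeOn p q M r S T) (hr : 3 * L ≤ r)
    (h1 : r + 6 * D ≤ s) (h2 : s + (r + 6 * D) ≤ M) :
    colour₃ L x S D (p + s) = colour₃ L y T D (q + s) := by
  obtain ⟨e, he, h3, h4⟩ := h.nextIn (D := D) (s := s) (by omega) (by omega)
  rw [DocExchange.colour₃, DocExchange.colour₃, h3, h4, h.colour₂ hc hr (by omega) (by omega),
    h.colour₂ hc hr (by omega) (by omega)]

theorem AgreeOn.hasNear (h : AgreeOn p q M r S T) (h1 : r + 2 * D ≤ s)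
    (h2 : s + (r + 2 * D) ≤ M) : HasNear S D (p + s) ↔ HasNear T D (q + s) := by
  constructor
  · rintro ⟨j, hj, h3, h4, h5⟩
    obtain ⟨e, rfl⟩ : ∃ e, j = p + e := ⟨j - p, by omega⟩
    exact ⟨q + e, (h e (by omega) (by omega)).1 hj, by omega, by omega, by omega⟩
  · rintro ⟨j, hj, h3, h4, h5⟩
    obtain ⟨e, rfl⟩ : ∃ e, j = q + e := ⟨j - q, by omega⟩
    exact ⟨p + e, (h e (by omega) (by omega)).2 hj, by omega, by omega, by omega⟩

/-- Every colour class consults chosen points at distance less than `2 * D` and so moves the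
boundary of agreement by `2 * D`. This is how the number of colours enters the communication cost.
-/
theorem AgreeOn.thinUpTo (hc : Common x y p q M) (h : AgreeOn p q M r S T) (hr : 3 * L ≤ r)
    (c : ℕ) : AgreeOn p q M (r + 6 * D + 2 * D * c) (thinUpTo L x S D c) (thinUpTo L y T D c) := by
  induction c with
  | zero => simp [DocExchange.thinUpTo, AgreeOn]
  | succ c ih =>
    intro s h1 h2
    rw [Nat.mul_succ] at h1 h2
    have h3 : r + 2 * D ≤ r + 6 * D + 2 * D * c := by omega
    rw [thinUpTo_succ, thinUpTo_succ, mem_addColour, mem_addColour, h s (by omega) (by omega),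
      ih s (by omega) (by omega), h.colour₃ hc hr (by omega) (by omega),
      ih.hasNear (by omega) (by omega)]

/-- The level sets agree on a common piece away from its ends. -/
theorem agreeOn_level (hL : L ≠ 0) (hc : Common x y p q M) (c : ℕ) :
    AgreeOn p q M (3 * L + (6 + 2 * numColours L) * (2 ^ c - 1)) (level L x c) (level L y c) := by
  induction c with
  | zero =>
    intro s h1 h2
    have := hc.left
    have := hc.right
    simp only [level, List.range_zero, List.foldl_nil, List.mem_range]
    omega
  | succ c ih =>
    rw [level_succ, level_succ]
    refine (AgreeOn.thinUpTo (D := cappedPow L c) hc ih (by omega) (numColours L)).mono ?_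
    have h1 : cappedPow L c ≤ 2 ^ c := min_le_left _ _
    -- The losses are proportional to `2 ^ c` and form a geometric series, so summing over the
    -- levels costs no further logarithmic factor.
    have h2 : 2 ^ (c + 1) - 1 = 2 ^ c - 1 + 2 ^ c := by
      have := Nat.one_le_two_pow (n := c)
      rw [pow_succ]
      omega
    rw [h2, mul_add (6 + 2 * numColours L)]
    have h3 := Nat.mul_le_mul_left (6 + 2 * numColours L) h1
    have h4 : (6 + 2 * numColours L) * cappedPow L c =
      6 * cappedPow L c + 2 * cappedPow L c * numColours L := by ring
    omega

/-- The distance from the ends of a common piece at which the samples agree. -/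
def radius (L : ℕ) : ℕ := (10 + 2 * numColours L) * L

/-- Beyond the loss of the last level, the final filter looks ahead by less than `dist L ≤ L`;
together with the initial `3 * L` this accounts for the summand `4 * L` in `radius L`. -/
theorem agreeOn_sample (hL : L ≠ 0) (hc : Common x y p q M) :
    AgreeOn p q M (radius L) (sample L x) (sample L y) := by
  have h := agreeOn_level hL hc (Nat.log 2 L)
  have hr : 3 * L + (6 + 2 * numColours L) * (2 ^ Nat.log 2 L - 1) + dist L ≤ radius L := by
    have h1 := Nat.pow_log_le_self 2 hL
    have h2 := Nat.mul_le_mul_left (6 + 2 * numColours L) ((Nat.sub_le _ 1).trans h1)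
    have h3 := dist_le L
    have h4 : radius L = (6 + 2 * numColours L) * L + 4 * L := by unfold radius; ring
    omega
  intro s h1 h2
  rw [mem_sample, mem_sample, h s (by omega) (by omega)]
  refine and_congr_right fun _ => not_congr ⟨?_, ?_⟩
  · rintro ⟨j, hj, h3, h4⟩
    obtain ⟨e, rfl⟩ : ∃ e, j = p + e := ⟨j - p, by omega⟩
    exact ⟨q + e, (h e (by omega) (by omega)).1 hj, by omega, by omega⟩
  · rintro ⟨j, hj, h3, h4⟩
    obtain ⟨e, rfl⟩ : ∃ e, j = q + e := ⟨j - q, by omega⟩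
    exact ⟨p + e, (h e (by omega) (by omega)).2 hj, by omega, by omega⟩

/-! ### The effect of block edit errors on the set of sampled windows -/

/-- The windows at the sampled positions. -/
noncomputable def windows (L : ℕ) (x : List Bool) : Finset (List Bool) :=
  (sample L x).toFinset.image (window L x)

/-- The sampled positions in `{a, …, a + l - 1}`. -/
noncomputable def sampleIn (L : ℕ) (x : List Bool) (a l : ℕ) : Finset ℕ :=
  (sample L x).toFinset.filter (fun s => a ≤ s ∧ s < a + l)

/-- By separation, `s ↦ (s - a) / dist L` is injective on the sampled positions. -/
theorem card_sampleIn_le (hL : L ≠ 0) (x : List Bool) (a l : ℕ) :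
    (sampleIn L x a l).card ≤ l / dist L + 1 := by
  have hD := dist_pos hL
  rw [← Finset.card_range (l / dist L + 1)]
  have hsep := separated_sample L x
  refine Finset.card_le_card_of_injOn (fun s => (s - a) / dist L) (fun s hs => ?_) ?_
  · simp only [sampleIn, Finset.coe_filter, Set.mem_ofPred_eq] at hs
    simp only [Finset.coe_range, Set.mem_Iio]
    exact Nat.lt_succ_of_le (Nat.div_le_div_right (by omega))
  · have key : ∀ s ∈ sampleIn L x a l, ∀ s' ∈ sampleIn L x a l, s < s' →
        (s - a) / dist L < (s' - a) / dist L := by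
      intro s hs s' hs' hlt
      simp only [sampleIn, Finset.mem_filter, List.mem_toFinset] at hs hs'
      have h1 := hsep s hs.1 s' hs'.1 hlt
      have h2 : (s - a) / dist L + 1 ≤ (s' - a) / dist L := by
        rw [← Nat.add_div_right _ hD]
        exact Nat.div_le_div_right (by omega)
      omega
    intro s hs s' hs' heq
    simp only at heq
    rcases lt_trichotomy s s' with h | h | h
    · have := key s hs s' hs' h
      omega
    · exact h
    · have := key s' hs' s hs h
      omega

/-- The windows of `x` that start in `{a, …, a + l - 1}` and are not windows of `y`. -/
noncomputable def lost (L : ℕ) (x y : List Bool) (a l : ℕ) : Finset (List Bool) :=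
  (sampleIn L x a l).image (window L x) \ windows L y

theorem card_lost_le (hL : L ≠ 0) (x y : List Bool) (a l : ℕ) :
    (lost L x y a l).card ≤ l / dist L + 1 :=
  ((Finset.card_le_card Finset.sdiff_subset).trans Finset.card_image_le).trans
    (card_sampleIn_le hL x a l)

/-- A sampled position at least `radius L` from both ends is sampled in `y` too, and since `8 * L ≤
radius L` its window lies inside the common piece. Only windows starting in the two strips at the
ends can be lost. -/
theorem Common.card_lost_le (hL : L ≠ 0) (hc : Common x y p q M) :
    (lost L x y p M).card ≤ 2 * (radius L / dist L + 1) := by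
  have hr : 8 * L ≤ radius L := Nat.mul_le_mul_right _ (by omega)
  have hsub : lost L x y p M ⊆ (sampleIn L x p (radius L)).image (window L x) ∪
      (sampleIn L x (p + M - radius L) (radius L)).image (window L x) := by
    intro v hv
    simp only [lost, Finset.mem_sdiff, Finset.mem_image, sampleIn, Finset.mem_filter,
      List.mem_toFinset, windows, Finset.mem_union] at hv ⊢
    obtain ⟨⟨s, ⟨hs, h1, h2⟩, rfl⟩, hv⟩ := hv
    rcases lt_or_ge s (p + radius L) with h3 | h3
    · exact .inl ⟨s, ⟨hs, h1, h3⟩, rfl⟩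
    rcases le_or_gt (s + radius L) (p + M) with h4 | h4
    · obtain ⟨e, rfl⟩ : ∃ e, s = p + e := ⟨s - p, by omega⟩
      refine absurd ⟨q + e, (agreeOn_sample hL hc e (by omega) (by omega)).1 hs, ?_⟩ hv
      exact (hc.take_drop (by omega)).symm
    · exact .inr ⟨s, ⟨hs, by omega, by omega⟩, rfl⟩
  refine (Finset.card_le_card hsub).trans ((Finset.card_union_le _ _).trans ?_)
  have h1 := (Finset.card_image_le (f := window L x)).trans
    (card_sampleIn_le hL x p (radius L))
  have h2 := (Finset.card_image_le (f := window L x)).trans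
    (card_sampleIn_le hL x (p + M - radius L) (radius L))
  omega

theorem lost_add_subset (L : ℕ) (x y : List Bool) (a l l' : ℕ) :
    lost L x y a (l + l') ⊆ lost L x y a l ∪ lost L x y (a + l) l' := by
  intro v hv
  simp only [lost, Finset.mem_sdiff, Finset.mem_image, sampleIn, Finset.mem_filter,
    List.mem_toFinset, Finset.mem_union] at hv ⊢
  obtain ⟨⟨s, ⟨hs, h1, h2⟩, rfl⟩, hv⟩ := hv
  rcases lt_or_ge s (a + l) with h | h
  · exact .inl ⟨⟨s, ⟨hs, h1, h⟩, rfl⟩, hv⟩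
  · exact .inr ⟨⟨s, ⟨hs, h, by omega⟩, rfl⟩, hv⟩

theorem card_lost_add_le (L : ℕ) (x y : List Bool) (a l l' : ℕ) :
    (lost L x y a (l + l')).card ≤ (lost L x y a l).card + (lost L x y (a + l) l').card :=
  (Finset.card_le_card (lost_add_subset ..)).trans (Finset.card_union_le _ _)

theorem windows_sdiff_windows (L : ℕ) (x y : List Bool) :
    windows L x \ windows L y = lost L x y 0 x.length := by
  have : sampleIn L x 0 x.length = (sample L x).toFinset := by
    ext s
    simp only [sampleIn, Finset.mem_filter, List.mem_toFinset, zero_add, Nat.zero_le, true_and,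
      and_iff_left_iff_imp]
    exact sample_lt_length
  rw [lost, this, windows]

theorem common_of_append (a a' m b b' : List Bool) :
    Common (a ++ (m ++ b)) (a' ++ (m ++ b')) a.length a'.length m.length :=
  ⟨by simp, by simp, by simp⟩

theorem BlockEdit.symm {α : Type*} {s : ℕ} {x y : List α} (h : BlockEdit s x y) :
    BlockEdit s y x := by
  cases h with
  | insertion a b c => exact .deletion a b c
  | deletion a b c => exact .insertion a b c
  | transposition a b c d => exact .transposition a c b d

/-- An edit cuts `x` into at most four pieces that reappear in `y`, each losing windows at its two
ends, plus possibly a deleted block of `s` symbols, all of whose windows may be lost. -/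
theorem BlockEdit.card_sdiff_le (hL : L ≠ 0) (h : BlockEdit s x y) :
    (windows L x \ windows L y).card ≤ 8 * (radius L / dist L + 1) + (s / dist L + 1) := by
  rw [windows_sdiff_windows]
  have h0 := Nat.zero_le (s / dist L)
  cases h with
  | insertion a b c =>
    have h1 := (common_of_append [] [] a c (b ++ c)).card_lost_le hL
    have h2 := (common_of_append a (a ++ b) c [] []).card_lost_le hL
    have h3 := card_lost_add_le L (a ++ c) (a ++ b ++ c) 0 a.length c.length
    simp only [List.nil_append, List.append_nil, List.append_assoc, List.length_append,
      List.length_nil, zero_add] at *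
    omega
  | deletion a b c =>
    have h1 := (common_of_append [] [] a (b ++ c) c).card_lost_le hL
    have h2 := (common_of_append (a ++ b) a c [] []).card_lost_le hL
    have h3 := card_lost_add_le L (a ++ b ++ c) (a ++ c) 0 (a.length + b.length) c.length
    have h4 := card_lost_add_le L (a ++ b ++ c) (a ++ c) 0 a.length b.length
    have h5 := DocExchange.card_lost_le hL (a ++ b ++ c) (a ++ c) a.length b.length
    simp only [List.nil_append, List.append_nil, List.append_assoc, List.length_append,
      List.length_nil, zero_add] at *
    simp only [add_assoc] at *
    omega
  | transposition a b c d =>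
    have h1 := (common_of_append [] [] a (b ++ (c ++ d)) (c ++ (b ++ d))).card_lost_le hL
    have h2 := (common_of_append a (a ++ c) b (c ++ d) d).card_lost_le hL
    have h3 := (common_of_append (a ++ b) a c d (b ++ d)).card_lost_le hL
    have h4 := (common_of_append (a ++ (b ++ c)) (a ++ (c ++ b)) d [] []).card_lost_le hL
    have h5 := card_lost_add_le L (a ++ b ++ c ++ d) (a ++ c ++ b ++ d) 0
      (a.length + b.length + c.length) d.length
    have h6 := card_lost_add_le L (a ++ b ++ c ++ d) (a ++ c ++ b ++ d) 0
      (a.length + b.length) c.length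
    have h7 := card_lost_add_le L (a ++ b ++ c ++ d) (a ++ c ++ b ++ d) 0 a.length b.length
    simp only [List.nil_append, List.append_nil, List.append_assoc, List.length_append,
      List.length_nil, zero_add] at *
    simp only [add_assoc] at *
    omega

theorem BlockEdit.card_symmDiff_le (hL : L ≠ 0) (h : BlockEdit s x y) :
    (symmDiff (windows L x) (windows L y)).card ≤
      16 * (radius L / dist L + 1) + 2 * (s / dist L + 1) := by
  have h1 := h.card_sdiff_le hL
  have h2 := h.symm.card_sdiff_le hL
  have h3 := Finset.card_union_le (windows L x \ windows L y) (windows L y \ windows L x)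
  change (windows L x \ windows L y ∪ windows L y \ windows L x).card ≤ _
  omega

/-- The triangle inequality for symmetric differences adds up the single edits. The rounding loss of
each division is part of the cost per edit, and the floors add up to at most `t / dist L`. -/
theorem BlockEdits.card_symmDiff_le (hL : L ≠ 0) {k t : ℕ} (h : BlockEdits k t x y) :
    (symmDiff (windows L x) (windows L y)).card ≤
      k * (16 * (radius L / dist L + 1) + 2) + 2 * (t / dist L) := by
  induction h with
  | none k t x => simp
  | @step k t s x y z h _ ih =>
    have h1 := h.card_symmDiff_le hL
    have h2 : (symmDiff (windows L x) (windows L z)).card ≤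
        (symmDiff (windows L x) (windows L y)).card +
          (symmDiff (windows L y) (windows L z)).card :=
      (Finset.card_le_card (symmDiff_triangle _ _ _)).trans (Finset.card_union_le _ _)
    have h3 : s / dist L + t / dist L ≤ (s + t) / dist L := Nat.div_add_div_le_add_div
    rw [Nat.add_mul, Nat.one_mul]
    omega

theorem radius_div_dist_le (hL : L ≠ 0) : radius L / dist L ≤ 20 + 4 * numColours L := by
  refine Nat.div_le_of_le_mul ?_
  have := Nat.mul_le_mul_left (10 + 2 * numColours L) (lt_two_mul_dist hL).le
  unfold radius
  linarith

end DocExchange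

namespace DocExchange

/-! ### Decoding power sums over a prime field -/

section Field

variable {P : ℕ} [Fact (P + 1).Prime]

theorem sum_map_range {R : Type*} [AddCommMonoid R] (f : ℕ → R) (N : ℕ) :
    ((List.range N).map f).sum = ∑ i ∈ Finset.range N, f i := by
  induction N with
  | zero => simp
  | succ N ih => simp [List.range_succ, Finset.sum_range_succ, ih]

/-- The vector over the prime field that a list of residues represents. -/
def vec (P N : ℕ) (b : List ℕ) : Fin N → ZMod (P + 1) := fun i => (b.getD i 0 : ZMod (P + 1))

/-- The inner product with a sequence, as a linear form. -/
def form (P N : ℕ) (s : ℕ → ZMod (P + 1)) : (Fin N → ZMod (P + 1)) →ₗ[ZMod (P + 1)] ZMod (P + 1) where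
  toFun v := ∑ i, v i * s i
  map_add' u v := by simp [add_mul, Finset.sum_add_distrib]
  map_smul' c v := by simp [Finset.mul_sum, mul_assoc]

theorem form_apply (N : ℕ) (s : ℕ → ZMod (P + 1)) (v : Fin N → ZMod (P + 1)) :
    form P N s v = ∑ i, v i * s i := rfl

theorem cast_dot (N : ℕ) (u v : List ℕ) :
    (dot P N u v : ZMod (P + 1)) = form P N (fun i => (v.getD i 0 : ZMod (P + 1))) (vec P N u) := by
  rw [dot, ZMod.natCast_mod, sum_map_range, form_apply, Nat.cast_sum, Finset.sum_range]
  simp [vec]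

theorem natCast_inj {a b : ℕ} (ha : a < P + 1) (hb : b < P + 1)
    (h : (a : ZMod (P + 1)) = b) : a = b := by
  have := (ZMod.natCast_eq_natCast_iff' a b (P + 1)).1 h
  rwa [Nat.mod_eq_of_lt ha, Nat.mod_eq_of_lt hb] at this

theorem dot_eq_zero (N : ℕ) (u v : List ℕ) : dot P N u v = 0 ↔
    form P N (fun i => (v.getD i 0 : ZMod (P + 1))) (vec P N u) = 0 := by
  rw [← cast_dot]
  refine ⟨fun h => by rw [h, Nat.cast_zero], fun h => ?_⟩
  exact natCast_inj (Nat.mod_lt _ P.succ_pos) P.succ_pos (by rw [h, Nat.cast_zero])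

/-! ### Gaussian elimination with spanning lists of fixed length -/

/-- The list `b` consists of `N` vectors that span `K`. -/
def Spans (P N : ℕ) (b : List (List ℕ)) (K : Submodule (ZMod (P + 1)) (Fin N → ZMod (P + 1))) :
    Prop :=
  b.length = N ∧ Submodule.span (ZMod (P + 1)) (vec P N '' {c | c ∈ b}) = K

/-- In `eliminate` the natural number `P + 1 - dot …` plays the role of the negative of the inner
product. -/
theorem vec_eliminate (N : ℕ) (row : List ℕ) (b : List (List ℕ)) (c : List ℕ) (r : ℕ) :
    vec P N (eliminate P N row b c r) =
      form P N (fun i => (row.getD i 0 : ZMod (P + 1))) (vec P N c) • vec P N (b.getD r []) -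
      form P N (fun i => (row.getD i 0 : ZMod (P + 1))) (vec P N (b.getD r [])) • vec P N c := by
  ext i
  have h : dot P N (b.getD r []) row ≤ P + 1 := (Nat.mod_lt _ P.succ_pos).le
  simp only [vec, Pi.sub_apply, Pi.smul_apply, smul_eq_mul, eliminate]
  rw [List.getD_eq_getElem _ _ (by simp)]
  simp only [List.getElem_map, List.getElem_range, ZMod.natCast_mod, Nat.cast_add, Nat.cast_mul,
    Nat.cast_sub h, cast_dot]
  have h0 : ((P : ZMod (P + 1)) + 1) = 0 := by exact_mod_cast ZMod.natCast_self (P + 1)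
  simp only [Nat.cast_one, h0]
  ring

/-- With `w` the linear form of `row` and a pivot `c`, `w c ≠ 0`, each `v` is replaced by `w c • v -
w v • c`. This lies in the kernel of `w` and equals `w c • v` if `v` was there before, so nothing is
lost. No inverses are needed, and the list need only span, so its length stays `N`. -/
theorem Spans.orthStep {N : ℕ} {b : List (List ℕ)}
    {K : Submodule (ZMod (P + 1)) (Fin N → ZMod (P + 1))} (h : Spans P N b K) (row : List ℕ) :
    Spans P N (orthStep P N b row)
      (K ⊓ LinearMap.ker (form P N (fun i => (row.getD i 0 : ZMod (P + 1))))) := by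
  obtain ⟨hlen, hK⟩ := h
  set w := form P N (fun i => (row.getD i 0 : ZMod (P + 1))) with hw
  unfold DocExchange.orthStep
  split_ifs with hpiv
  · refine ⟨hlen, ?_⟩
    rw [hK, left_eq_inf, ← hK, Submodule.span_le]
    rintro _ ⟨c, hc, rfl⟩
    have := List.filter_eq_nil_iff.1 hpiv c hc
    simp only [ne_eq, decide_not, Bool.not_eq_eq_eq_not, Bool.not_true, decide_eq_false_iff_not,
      not_not, dot_eq_zero] at this
    exact this
  · have hc := headD_mem (d := []) hpiv
    generalize (b.filter (fun c => dot P N c row ≠ 0)).headD [] = c at *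
    simp only [List.mem_filter, ne_eq, decide_not, Bool.not_eq_eq_eq_not, Bool.not_true,
      decide_eq_false_iff_not, dot_eq_zero, ← hw] at hc
    obtain ⟨hcb, hc0⟩ := hc
    refine ⟨by simp, le_antisymm ?_ ?_⟩
    · rw [Submodule.span_le]
      rintro _ ⟨e, he, rfl⟩
      obtain ⟨r, hr, rfl⟩ := List.mem_map.1 he
      rw [List.mem_range] at hr
      rw [vec_eliminate, ← hw]
      have h1 : vec P N c ∈ K := hK ▸ Submodule.subset_span ⟨c, hcb, rfl⟩
      have h2 : vec P N (b.getD r []) ∈ K := by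
        rw [List.getD_eq_getElem _ _ (by omega)]
        exact hK ▸ Submodule.subset_span ⟨_, List.getElem_mem _, rfl⟩
      refine ⟨K.sub_mem (K.smul_mem _ h2) (K.smul_mem _ h1), ?_⟩
      simp only [SetLike.mem_coe, LinearMap.mem_ker, map_sub, map_smul, smul_eq_mul]
      ring
    · intro v hv
      have key : ∀ v ∈ K, w (vec P N c) • v - w v • vec P N c ∈ Submodule.span (ZMod (P + 1))
          (vec P N '' {e | e ∈ (List.range N).map (fun r => eliminate P N row b c r)}) := by
        intro v hv
        rw [← hK] at hv
        induction hv using Submodule.span_induction with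
        | mem v hv =>
          obtain ⟨e, he, rfl⟩ := hv
          obtain ⟨r, hr, rfl⟩ := List.getElem_of_mem he
          refine Submodule.subset_span ⟨eliminate P N row b c r, ?_, ?_⟩
          · exact List.mem_map.2 ⟨r, List.mem_range.2 (by omega), rfl⟩
          · rw [vec_eliminate, List.getD_eq_getElem _ _ hr]
        | zero => simp
        | add u v _ _ hu hv =>
          have := Submodule.add_mem _ hu hv
          convert this using 1
          rw [map_add, smul_add, add_smul]
          abel
        | smul a v _ hv =>
          have := Submodule.smul_mem _ a hv
          convert this using 1
          rw [map_smul, smul_sub, smul_comm, smul_eq_mul, mul_smul]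
      have := key v hv.1
      rw [LinearMap.mem_ker.1 hv.2, zero_smul, sub_zero] at this
      exact (Submodule.smul_mem_iff _ hc0).1 this

theorem spans_unitVectors (N : ℕ) : Spans P N (unitVectors N) ⊤ := by
  refine ⟨by simp [unitVectors], eq_top_iff.2 fun v _ => ?_⟩
  rw [pi_eq_sum_univ v]
  refine Submodule.sum_mem _ fun j _ => Submodule.smul_mem _ _ (Submodule.subset_span
    ⟨(List.range N).map (fun i : ℕ => if i = (j : ℕ) then 1 else 0), ?_, ?_⟩)
  · exact List.mem_map.2 ⟨j, List.mem_range.2 j.2, rfl⟩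
  · ext i
    simp [vec, Fin.ext_iff, eq_comm]

/-! ### Prony's method: the nodes of an exponential sum as common roots -/

/-- The space of the recurrences of length `d` of a sequence. -/
def recSpace (P d : ℕ) (s : ℕ → ZMod (P + 1)) (c : ℕ) :
    Submodule (ZMod (P + 1)) (Fin (d + 1) → ZMod (P + 1)) :=
  ⨅ j ∈ Finset.range c, LinearMap.ker (form P (d + 1) (fun i => s (j + i)))

theorem spans_recurrences (d : ℕ) (σ : List ℕ) :
    Spans P (d + 1) (recurrences P d σ)
      (recSpace P d (fun i => (σ.getD i 0 : ZMod (P + 1))) d) := by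
  suffices h : ∀ c, Spans P (d + 1)
      ((List.range c).foldl (fun b j => orthStep P (d + 1) b (σ.drop j)) (unitVectors (d + 1)))
      (recSpace P d (fun i => (σ.getD i 0 : ZMod (P + 1))) c) from h d
  intro c
  induction c with
  | zero => simpa [recSpace] using spans_unitVectors (d + 1)
  | succ c ih =>
    have := ih.orthStep (σ.drop c)
    have hrec : recSpace P d (fun i => (σ.getD i 0 : ZMod (P + 1))) (c + 1) =
        recSpace P d (fun i => (σ.getD i 0 : ZMod (P + 1))) c ⊓
          LinearMap.ker (form P (d + 1) (fun i => ((σ.drop c).getD i 0 : ZMod (P + 1)))) := by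
      simp only [recSpace, Finset.range_add_one, Finset.iInf_insert, List.getD_eq_getElem?_getD,
        List.getElem?_drop]
      exact inf_comm _ _
    rw [List.range_succ, List.foldl_append, hrec]
    exact this

/-- Vanishing at `m` is a linear condition on the coefficient vector, so it suffices to test a
spanning list. -/
theorem isCommonRoot_iff {d : ℕ} {b : List (List ℕ)}
    {K : Submodule (ZMod (P + 1)) (Fin (d + 1) → ZMod (P + 1))} (h : Spans P (d + 1) b K) (m : ℕ) :
    IsCommonRoot P d b m ↔ ∀ v ∈ K, form P (d + 1) (fun i => (m : ZMod (P + 1)) ^ i) v = 0 := by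
  have hf : form P (d + 1) (fun i => ((((List.range (d + 1)).map (fun i => powMod P m i)).getD i 0 :
      ℕ) : ZMod (P + 1))) = form P (d + 1) (fun i => (m : ZMod (P + 1)) ^ i) := by
    ext v
    simp only [LinearMap.coe_comp, Function.comp_apply, form_apply]
    refine Finset.sum_congr rfl fun i _ => ?_
    rw [List.getD_eq_getElem _ _ (by simpa using i.is_le)]
    simp [powMod]
  rw [IsCommonRoot, not_exists]
  constructor
  · intro h1
    rw [← h.2]
    have : Submodule.span (ZMod (P + 1)) (vec P (d + 1) '' {c | c ∈ b}) ≤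
        LinearMap.ker (form P (d + 1) (fun i => (m : ZMod (P + 1)) ^ i)) := by
      rw [Submodule.span_le]
      rintro _ ⟨c, hc, rfl⟩
      by_contra hne
      refine h1 c ⟨hc, fun h0 => hne ?_⟩
      rw [dot_eq_zero, hf] at h0
      exact h0
    exact fun v hv => this hv
  · rintro h1 c ⟨hc, h2⟩
    refine h2 ?_
    rw [dot_eq_zero, hf]
    exact h1 _ (h.2 ▸ Submodule.subset_span ⟨c, hc, rfl⟩)

open Polynomial in
theorem form_coeff {d : ℕ} {f : (ZMod (P + 1))[X]} (hf : f.natDegree < d + 1)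
    (z : ZMod (P + 1)) : form P (d + 1) (fun i => z ^ i) (fun i => f.coeff i) = f.eval z := by
  rw [form_apply, Polynomial.eval_eq_sum_range' hf, Finset.sum_range]

open Polynomial in
/-- The common roots of the recurrences of a short exponential sum are its nodes. -/
theorem forall_recSpace_iff {d : ℕ} {s ε : ℕ → ZMod (P + 1)} {Δ : Finset ℕ} (hd : Δ.card ≤ d)
    (hΔ : ∀ u ∈ Δ, u < P + 1) (hε : ∀ u ∈ Δ, ε u ≠ 0)
    (hs : ∀ j < 2 * d, s j = ∑ u ∈ Δ, ε u * (u : ZMod (P + 1)) ^ j) {m : ℕ} (hm : m < P + 1) :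
    (∀ v ∈ recSpace P d s d, form P (d + 1) (fun i => (m : ZMod (P + 1)) ^ i) v = 0) ↔ m ∈ Δ := by
  -- Read `v` as a polynomial of degree at most `d`: applying it to the sequence shifted by `j`
  -- multiplies the weight of each node by its value there. The indices `j + i` stay below `2 * d`,
  -- which is why `2 * d` power sums are sent.
  have hform : ∀ v, ∀ j < d, form P (d + 1) (fun i => s (j + i)) v =
      ∑ u ∈ Δ, ε u * form P (d + 1) (fun i => (u : ZMod (P + 1)) ^ i) v *
        (u : ZMod (P + 1)) ^ j := by
    intro v j hj
    simp only [form_apply, Finset.mul_sum, Finset.sum_mul]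
    rw [Finset.sum_comm]
    refine Finset.sum_congr rfl fun i _ => ?_
    rw [hs (j + i) (by omega), Finset.mul_sum]
    refine Finset.sum_congr rfl fun u _ => ?_
    rw [pow_add]
    ring
  have hmem : ∀ v, v ∈ recSpace P d s d ↔ ∀ j < d, ∑ u ∈ Δ, ε u *
      form P (d + 1) (fun i => (u : ZMod (P + 1)) ^ i) v * (u : ZMod (P + 1)) ^ j = 0 := by
    intro v
    simp only [recSpace, Submodule.mem_iInf, Finset.mem_range, LinearMap.mem_ker]
    exact forall₂_congr fun j hj => by rw [hform v j hj]
  have hne : ∀ u ∈ Δ, u ≠ m → (m : ZMod (P + 1)) - (u : ZMod (P + 1)) ≠ 0 := fun u hu hum h =>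
    hum (natCast_inj hm (hΔ u hu) (sub_eq_zero.1 h)).symm
  have hdeg : ∀ A : Finset ℕ, (∏ u ∈ A, (X - C (u : ZMod (P + 1)))).natDegree = A.card := fun A => by
    rw [Polynomial.natDegree_prod_of_monic _ _ fun u _ => monic_X_sub_C _]
    simp only [natDegree_X_sub_C, Finset.sum_const, smul_eq_mul, mul_one]
  constructor
  · intro h
    by_contra hmΔ
    -- The polynomial with simple roots exactly at the nodes has degree at most `d` and is a
    -- recurrence, but it does not vanish at any other residue.
    have h1 := h (fun i => (∏ u ∈ Δ, (X - C (u : ZMod (P + 1)))).coeff i) ((hmem _).2 ?_)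
    · rw [form_coeff (by rw [hdeg]; omega), Polynomial.eval_prod, Finset.prod_eq_zero_iff] at h1
      obtain ⟨u, hu, h1⟩ := h1
      refine hne u hu (fun h => hmΔ (h ▸ hu)) (by simpa using h1)
    · intro j _
      refine Finset.sum_eq_zero fun u hu => ?_
      rw [form_coeff (by rw [hdeg]; omega), Polynomial.eval_prod,
        Finset.prod_eq_zero hu (by simp)]
      simp
  · intro hmΔ v hv
    have hv := (hmem v).1 hv
    -- Combining the `d` equations with the coefficients of `f`, of degree less than `d`, cancels
    -- all nodes except `m`; the weight of `m` and `f` at `m` are nonzero, so `v` vanishes at `m`.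
    set f := ∏ u ∈ Δ.erase m, (X - C (u : ZMod (P + 1))) with hf
    have hcard := Finset.card_pos.2 ⟨m, hmΔ⟩
    have hfd : f.natDegree < d := by
      rw [hf, hdeg, Finset.card_erase_of_mem hmΔ]
      omega
    have h0 : ∑ u ∈ Δ, ε u * form P (d + 1) (fun i => (u : ZMod (P + 1)) ^ i) v *
        f.eval (u : ZMod (P + 1)) = 0 := by
      simp only [Polynomial.eval_eq_sum_range' hfd, Finset.mul_sum]
      rw [Finset.sum_comm]
      refine Finset.sum_eq_zero fun j hj => ?_
      have := congrArg (f.coeff j * ·) (hv j (Finset.mem_range.1 hj))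
      simp only [mul_zero, Finset.mul_sum] at this
      rw [← this]
      exact Finset.sum_congr rfl fun u _ => by ring
    rw [Finset.sum_eq_single_of_mem m hmΔ fun u hu hum => ?_] at h0
    · have h1 : f.eval (m : ZMod (P + 1)) ≠ 0 := by
        rw [hf, Polynomial.eval_prod, Finset.prod_ne_zero_iff]
        intro u hu
        rw [Finset.mem_erase] at hu
        simpa using hne u hu.2 hu.1
      simpa [hε m hmΔ, h1] using h0
    · rw [hf, Polynomial.eval_prod, Finset.prod_eq_zero (Finset.mem_erase.2 ⟨hum, hu⟩) (by simp)]
      simp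

theorem cast_powerSums {N : ℕ} {A : List ℕ} (hA : A.Nodup) {j : ℕ} (hj : j < N) :
    ((powerSums P N A).getD j 0 : ZMod (P + 1)) = ∑ u ∈ A.toFinset, (u : ZMod (P + 1)) ^ j := by
  rw [powerSums, List.getD_eq_getElem _ _ (by simpa)]
  simp only [List.getElem_map, List.getElem_range, ZMod.natCast_mod, Nat.cast_list_sum,
    List.map_map]
  rw [List.sum_toFinset _ hA]
  congr 1
  refine List.map_congr_left fun u _ => ?_
  simp [powMod]

/-- The common elements of `A` and `A'` cancel in the difference of the power sums, leaving weights
`1` and `-1` on the symmetric difference. Its elements are the common roots, and toggling them turns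
`A'` into `A`. -/
theorem mem_correct_iff {d : ℕ} {A A' : List ℕ} (hA : A.Nodup) (hA' : A'.Nodup)
    (hAP : ∀ m ∈ A, m < P + 1) (hAP' : ∀ m ∈ A', m < P + 1)
    (hd : (symmDiff A.toFinset A'.toFinset).card ≤ d) {m : ℕ} :
    m ∈ correct P d (recurrences P d (subMod P (2 * d) (powerSums P (2 * d) A)
      (powerSums P (2 * d) A'))) A' ↔ m ∈ A := by
  set σ := subMod P (2 * d) (powerSums P (2 * d) A) (powerSums P (2 * d) A')
  have hs : ∀ j < 2 * d, (σ.getD j 0 : ZMod (P + 1)) = ∑ u ∈ symmDiff A.toFinset A'.toFinset,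
      (if u ∈ A then 1 else -1) * (u : ZMod (P + 1)) ^ j := by
    intro j hj
    have hle : (powerSums P (2 * d) A').getD j 0 ≤ (powerSums P (2 * d) A).getD j 0 + (P + 1) := by
      refine le_add_left ?_
      rw [powerSums, List.getD_eq_getElem _ _ (by simpa)]
      simp only [List.getElem_map]
      exact (Nat.mod_lt _ P.succ_pos).le
    have h1 : (σ.getD j 0 : ZMod (P + 1)) = ∑ u ∈ A.toFinset, (u : ZMod (P + 1)) ^ j -
        ∑ u ∈ A'.toFinset, (u : ZMod (P + 1)) ^ j := by
      rw [← cast_powerSums hA hj, ← cast_powerSums hA' hj]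
      simp only [σ, subMod]
      rw [List.getD_eq_getElem _ _ (by simpa)]
      simp only [List.getElem_map, List.getElem_range, ZMod.natCast_mod]
      rw [Nat.cast_sub hle, Nat.cast_add, ZMod.natCast_self, add_zero]
    rw [h1, ← Finset.sum_inter_add_sum_sdiff A.toFinset A'.toFinset,
      ← Finset.sum_inter_add_sum_sdiff A'.toFinset A.toFinset, Finset.inter_comm A'.toFinset,
      symmDiff_def, Finset.sup_eq_union, Finset.sum_union
        (Finset.disjoint_left.2 fun u hu hu' => by simp at hu hu'; tauto), add_sub_add_left_eq_sub,
      sub_eq_add_neg, ← Finset.sum_neg_distrib]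
    congr 1
    · refine Finset.sum_congr rfl fun u hu => ?_
      rw [if_pos (by simp at hu; tauto), one_mul]
    · refine Finset.sum_congr rfl fun u hu => ?_
      rw [if_neg (by simp at hu; tauto), neg_one_mul]
  have hroot : ∀ m < P + 1, (IsCommonRoot P d (recurrences P d σ) m ↔
      m ∈ symmDiff A.toFinset A'.toFinset) := fun m hm => by
    rw [isCommonRoot_iff (spans_recurrences d σ)]
    refine forall_recSpace_iff hd (fun u hu => ?_) (fun u _ => ?_) hs hm
    · simp only [Finset.mem_symmDiff, List.mem_toFinset] at hu
      rcases hu with hu | hu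
      · exact hAP u hu.1
      · exact hAP' u hu.1
    · split_ifs <;> simp
  simp only [correct, List.mem_filter, List.mem_range, decide_eq_true_eq]
  constructor
  · rintro ⟨hm, h⟩
    rw [hroot m hm, Finset.mem_symmDiff, List.mem_toFinset, List.mem_toFinset] at h
    tauto
  · intro hm
    rw [hroot m (hAP m hm), Finset.mem_symmDiff, List.mem_toFinset, List.mem_toFinset]
    exact ⟨hAP m hm, by tauto⟩

end Field

end DocExchange

namespace DocExchange

/-! ### Codes of windows -/

theorem two_pow_length_le_foldr (v : List Bool) :
    2 ^ v.length ≤ v.foldr (fun b a => 2 * a + b.toNat) 1 ∧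
      v.foldr (fun b a => 2 * a + b.toNat) 1 < 2 ^ (v.length + 1) := by
  induction v with
  | nil => simp
  | cons b v ih =>
    have := b.toNat_le
    simp only [List.foldr_cons, List.length_cons, pow_succ] at *
    omega

/-- The truncation in `code` only keeps values small on arbitrary inputs; on strings as short as the
windows it is inactive. -/
theorem code_eq_foldr {N : ℕ} {v : List Bool} (h : 2 ^ (v.length + 1) ≤ N) :
    code N v = v.foldr (fun b a => 2 * a + b.toNat) 1 := by
  induction v with
  | nil => rfl
  | cons b v ih =>
    have h1 := (two_pow_length_le_foldr (b :: v)).2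
    have h2 := ih (by simp only [List.length_cons, pow_succ] at *; omega)
    simp only [code, List.foldr_cons] at *
    rw [h2]
    omega

theorem code_lt {N : ℕ} {v : List Bool} (h : 2 ^ (v.length + 1) ≤ N) : code N v < N := by
  rw [code_eq_foldr h]
  exact (two_pow_length_le_foldr v).2.trans_le h

/-- The leading one marks the length, which `Nat.log 2` reads off; this matters because windows near
the end of the string are shorter. -/
theorem decode_code {N : ℕ} {v : List Bool} (h : 2 ^ (v.length + 1) ≤ N) :
    decode (code N v) = v := by
  rw [code_eq_foldr h]
  have hlog : ∀ v : List Bool,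
      Nat.log 2 (v.foldr (fun b a => 2 * a + b.toNat) 1) = v.length := fun v =>
    (Nat.log_eq_iff (.inr ⟨by norm_num, by
      have := (two_pow_length_le_foldr v).1
      have := Nat.one_le_two_pow (n := v.length)
      omega⟩)).2 (two_pow_length_le_foldr v)
  clear h
  induction v with
  | nil => simp [decode, bits]
  | cons b v ih =>
    rw [decode, hlog] at ih ⊢
    rw [bits, List.length_cons, List.range_succ_eq_map, List.map_cons, List.foldr_cons,
      ← Nat.bit_val, Nat.testBit_bit_zero, List.map_map]
    congr 1
    refine (List.map_congr_left fun j _ => ?_).trans ih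
    exact Nat.testBit_bit_succ ..

/-! ### The parameters -/

theorem lt_two_pow_lg (n : ℕ) : n < 2 ^ lg n := Nat.lt_pow_succ_log_self (by norm_num) n

theorem two_pow_lg_le {n : ℕ} (hn : n ≠ 0) : 2 ^ lg n ≤ 2 * n := by
  have := Nat.pow_log_le_self 2 hn
  rw [lg, pow_succ]
  omega

theorem lg_ne_zero (n : ℕ) : lg n ≠ 0 := Nat.succ_ne_zero _

theorem two_pow_le_codeBound {n l : ℕ} (hn : n ≠ 0) (hl : l ≤ 8 * lg n) :
    2 ^ (l + 1) ≤ codeBound n := by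
  refine (Nat.pow_le_pow_right (by norm_num) (Nat.add_le_add_right hl 1)).trans ?_
  rw [codeBound, pow_succ, mul_comm, mul_comm 8, pow_mul]
  exact Nat.mul_le_mul_left 2 (Nat.pow_le_pow_left (two_pow_lg_le hn) 8)

/-- Bertrand's postulate makes the search succeed. The prime is polynomial in `n`, so that all
residues can be enumerated. -/
theorem modPred_spec {n : ℕ} (hn : n ≠ 0) : (modPred n + 1).Prime ∧ codeBound n < modPred n + 1 ∧
    modPred n + 1 ≤ 2 * codeBound n := by
  have h0 : codeBound n ≠ 0 := by
    have := two_pow_le_codeBound (l := 0) hn (Nat.zero_le _)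
    omega
  obtain ⟨p, hp, h1, h2⟩ := Nat.exists_prime_lt_and_le_two_mul _ h0
  have hmem : p ∈ (List.range (2 * codeBound n + 1)).filter
      (fun p => codeBound n < p ∧ p.Prime) := by
    simp only [List.mem_filter, List.mem_range, decide_eq_true_eq]
    exact ⟨by omega, h1, hp⟩
  have h := headD_mem (d := 0) (List.ne_nil_of_mem hmem)
  unfold modPred
  generalize ((List.range (2 * codeBound n + 1)).filter
      (fun p => codeBound n < p ∧ p.Prime)).headD 0 = p' at *
  simp only [List.mem_filter, List.mem_range, decide_eq_true_eq] at h
  rw [Nat.sub_add_cancel (by omega)]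
  exact ⟨h.2.2, h.2.1, by omega⟩

theorem modPred_lt_two_pow {n : ℕ} (hn : n ≠ 0) : modPred n + 1 < 2 ^ residueWidth n := by
  refine (modPred_spec hn).2.2.trans_lt ?_
  have h : (2 * n) ^ 8 ≤ (2 * 2 ^ lg n) ^ 8 :=
    Nat.pow_le_pow_left (Nat.mul_le_mul_left 2 (lt_two_pow_lg n).le) 8
  have h1 : (2 * 2 ^ lg n) ^ 8 = 2 ^ 8 * 2 ^ (8 * lg n) := by rw [mul_pow, ← pow_mul, mul_comm 8]
  have h2 : 2 ^ residueWidth n = 2 ^ (8 * lg n) * 2 ^ 11 := by rw [residueWidth, pow_add]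
  have h3 : 0 < 2 ^ (8 * lg n) := by positivity
  unfold codeBound
  omega

theorem length_window_le (L : ℕ) (x : List Bool) (s : ℕ) : (window L x s).length ≤ 8 * L :=
  List.length_take_le _ _

theorem mem_codeSet {n m : ℕ} (hn : n ≠ 0) {y : List Bool} :
    m ∈ codeSet n y ↔ ∃ s ∈ sample (lg n) y, code (codeBound n) (window (lg n) y s) = m := by
  simp only [codeSet, List.mem_filter, List.mem_range, decide_eq_true_eq, and_iff_right_iff_imp]
  rintro ⟨s, -, rfl⟩
  exact (code_lt (two_pow_le_codeBound hn (length_window_le ..))).trans (modPred_spec hn).2.1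

theorem toFinset_codeSet {n : ℕ} (hn : n ≠ 0) (y : List Bool) :
    (codeSet n y).toFinset = (windows (lg n) y).image (code (codeBound n)) := by
  ext m
  simp [mem_codeSet hn, windows]

theorem symmDiff_image_subset {α β : Type*} [DecidableEq α] [DecidableEq β] (f : α → β)
    (A A' : Finset α) : symmDiff (A.image f) (A'.image f) ⊆ (symmDiff A A').image f := by
  intro m hm
  simp only [Finset.mem_symmDiff, Finset.mem_image] at hm ⊢
  rcases hm with ⟨⟨v, hv, rfl⟩, h⟩ | ⟨⟨v, hv, rfl⟩, h⟩
  · exact ⟨v, .inl ⟨hv, fun hv' => h ⟨v, hv', rfl⟩⟩, rfl⟩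
  · exact ⟨v, .inr ⟨hv, fun hv' => h ⟨v, hv', rfl⟩⟩, rfl⟩

theorem card_symmDiff_codeSet_le {n k t : ℕ} (hn : n ≠ 0) {x y : List Bool}
    (h : BlockEdits k t x y) :
    (symmDiff (codeSet n x).toFinset (codeSet n y).toFinset).card ≤ errorBound n k t := by
  rw [toFinset_codeSet hn, toFinset_codeSet hn]
  refine ((Finset.card_le_card (symmDiff_image_subset _ _ _)).trans
    Finset.card_image_le).trans ((h.card_symmDiff_le (lg_ne_zero n)).trans ?_)
  refine Nat.add_le_add_right (Nat.mul_le_mul_left k ?_) _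
  -- The bound per edit is `16 * (21 + 4 * c) + 2 = 64 * c + 338` for `c` colours, below the `64 * c
  -- + 600` of `errorBound`.
  have := radius_div_dist_le (lg_ne_zero n)
  omega

/-! ### The message -/

theorem take_drop_flatten {w : ℕ} {l : List ℕ} {z : List Bool} {i : ℕ} (hi : i < l.length) :
    (((l.map (bits w)).flatten ++ z).drop (i * w)).take w = bits w l[i] := by
  induction l generalizing i with
  | nil => simp at hi
  | cons m l ih =>
    cases i with
    | zero => simp
    | succ i =>
      have := ih (i := i) (by simpa using hi)
      simp only [List.map_cons, List.flatten_cons, List.append_assoc, List.getElem_cons_succ]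
      rw [Nat.succ_mul, add_comm, ← List.drop_drop, List.drop_left' (by simp), this]

theorem length_flatten_bits (w : ℕ) (l : List ℕ) :
    ((l.map (bits w)).flatten).length = l.length * w := by
  induction l with
  | nil => simp
  | cons m l ih =>
    rw [List.map_cons, List.flatten_cons, List.length_append, ih, length_bits, List.length_cons,
      Nat.succ_mul, add_comm]

@[simp] theorem length_powerSums (P N : ℕ) (A : List ℕ) : (powerSums P N A).length = N := by
  simp [powerSums]

theorem receivedSums_message {n k t : ℕ} (hn : n ≠ 0) (x : List Bool) :
    receivedSums n (2 * errorBound n k t) (message n k t x) =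
      powerSums (modPred n) (2 * errorBound n k t) (codeSet n x) := by
  refine List.ext_getElem (by simp [receivedSums]) fun i hi hi' => ?_
  have hlt : (powerSums (modPred n) (2 * errorBound n k t) (codeSet n x))[i] < modPred n + 1 := by
    simp only [powerSums, List.getElem_map]
    exact Nat.mod_lt _ (Nat.succ_pos _)
  have h : ((message n k t x).drop (i * residueWidth n)).take (residueWidth n) =
      bits (residueWidth n) (powerSums (modPred n) (2 * errorBound n k t) (codeSet n x))[i] :=
    take_drop_flatten hi'
  generalize (powerSums (modPred n) (2 * errorBound n k t) (codeSet n x))[i] = m at *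
  simp only [receivedSums, List.getElem_map, List.getElem_range, h]
  have hmem : m ∈ (List.range (modPred n + 1)).filter
      (fun m' => bits (residueWidth n) m' = bits (residueWidth n) m) := by
    simpa [List.mem_filter] using hlt
  have h' := headD_mem (d := 0) (List.ne_nil_of_mem hmem)
  generalize ((List.range (modPred n + 1)).filter
      (fun m' => bits (residueWidth n) m' = bits (residueWidth n) m)).headD 0 = m' at *
  simp only [List.mem_filter, List.mem_range, decide_eq_true_eq] at h'
  have hw := modPred_lt_two_pow hn
  exact bits_injOn (by omega) (by omega) h'.2

theorem drop_message (n k t : ℕ) (x : List Bool) :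
    (message n k t x).drop (2 * errorBound n k t * residueWidth n) = x.take (8 * lg n) := by
  rw [message, List.drop_append_of_le_length (by rw [length_flatten_bits]; simp),
    List.drop_of_length_le (by rw [length_flatten_bits]; simp), List.nil_append]

theorem length_message_le (n k t : ℕ) (x : List Bool) :
    (message n k t x).length ≤ 2 * errorBound n k t * residueWidth n + 8 * lg n := by
  rw [message, List.length_append, length_flatten_bits, length_powerSums]
  exact Nat.add_le_add_left (List.length_take_le _ _) _

theorem nodup_codeSet (n : ℕ) (y : List Bool) : (codeSet n y).Nodup :=
  List.nodup_range.filter _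

theorem mem_recoveredCodes {n k t : ℕ} (hn : n ≠ 0) {x y : List Bool} (h : BlockEdits k t x y)
    {m : ℕ} : m ∈ recoveredCodes n (errorBound n k t) (message n k t x) y ↔ m ∈ codeSet n x := by
  have : Fact (modPred n + 1).Prime := ⟨(modPred_spec hn).1⟩
  have hlt : ∀ y, ∀ m ∈ codeSet n y, m < modPred n + 1 := fun y m hm =>
    List.mem_range.1 (List.mem_filter.1 hm).1
  rw [recoveredCodes, receivedSums_message hn]
  exact mem_correct_iff (nodup_codeSet n x) (nodup_codeSet n y) (hlt x) (hlt y)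
    (card_symmDiff_codeSet_le hn h)

theorem mem_map_decode {n k t : ℕ} (hn : n ≠ 0) {x y : List Bool} (h : BlockEdits k t x y)
    {v : List Bool} :
    v ∈ (recoveredCodes n (errorBound n k t) (message n k t x) y).map decode ↔
      ∃ s ∈ sample (lg n) x, window (lg n) x s = v := by
  simp only [List.mem_map, mem_recoveredCodes hn h, mem_codeSet hn]
  constructor
  · rintro ⟨_, ⟨s, hs, rfl⟩, rfl⟩
    exact ⟨s, hs, (decode_code (two_pow_le_codeBound hn (length_window_le ..))).symm⟩
  · rintro ⟨s, hs, rfl⟩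
    exact ⟨_, ⟨s, hs, rfl⟩, decode_code (two_pow_le_codeBound hn (length_window_le ..))⟩

/-! ### The reconstruction -/

-- The last `3 * L` symbols of the known prefix occur at one place in `x` only, so any window in
-- which they are followed by a symbol reveals the next symbol of `x`.
open scoped Classical in
theorem extend_take {L : ℕ} {x : List Bool} (hL : L ≠ 0) (hx : BDistinct (3 * L) x)
    {V : List (List Bool)} (hV : ∀ v, v ∈ V ↔ ∃ s ∈ sample L x, window L x s = v) {m : ℕ}
    (hm : 8 * L ≤ m) (hmx : m < x.length) :
    extend (3 * L) x.length V (x.take m) = x.take (m + 1) := by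
  have hlen : (x.take m).length = m := by simp [hmx.le]
  set u := (x.take m).drop (m - 3 * L) with hu
  have hu' : u = (x.drop (m - 3 * L)).take (3 * L) := by
    rw [hu, List.drop_take]
    congr 1
    omega
  -- By distinctness every match sits at the true position, so it does not matter which window and
  -- which index the search returns.
  have hwin : ∀ s i, HasAt (3 * L) u (window L x s) i →
      s + i + 3 * L = m ∧ (window L x s).getD (i + 3 * L) false = x[m] := by
    rintro s i ⟨h1, h2⟩
    have h3 : i + 3 * L < 8 * L := by
      have := length_window_le L x s
      omega
    have h4 : s + i + 3 * L < x.length := by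
      simp only [window, List.length_take, List.length_drop] at h2
      omega
    have h5 : s + i = m - 3 * L := by
      by_contra hne
      refine hx _ _ hne (by omega) (by omega) ?_
      rw [← hu', ← h1, window, List.drop_take, List.take_take, List.drop_drop,
        min_eq_left (by omega)]
    have h6 : s + i + 3 * L = m := by omega
    refine ⟨h6, ?_⟩
    rw [List.getD_eq_getElem _ _ h2]
    simp only [window, List.getElem_take, List.getElem_drop]
    congr 1
    omega
  -- The `4 * L` positions ending with `m - 3 * L` contain a sampled `s`. Then `s ≤ m - 3 * L` and
  -- `m < s + 7 * L`, so the window at `s` contains the last `3 * L` symbols and `x[m]`.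
  obtain ⟨s, hs, h1, h2⟩ := covers_sample hL hx (m - 3 * L + 1 - 4 * L) (by omega)
  have hsat : HasAt (3 * L) u (window L x s) (m - 3 * L - s) := by
    constructor
    · rw [hu', window, List.drop_take, List.take_take, List.drop_drop, min_eq_left (by omega)]
      congr 2
      omega
    · simp only [window, List.length_take, List.length_drop]
      omega
  unfold extend
  rw [if_pos (by rw [hlen]; exact hmx), hlen]
  simp only [← hu]
  have hmem : window L x s ∈
      V.filter (fun v => decide (∃ i ∈ List.range v.length, HasAt (3 * L) u v i)) := by
    rw [List.mem_filter]
    refine ⟨(hV _).2 ⟨s, hs, rfl⟩, ?_⟩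
    simp only [decide_eq_true_eq, List.mem_range]
    exact ⟨_, by have := hsat.2; omega, hsat⟩
  have hv := headD_mem (d := []) (List.ne_nil_of_mem hmem)
  generalize (V.filter (fun v => decide (∃ i ∈ List.range v.length, HasAt (3 * L) u v i))).headD [] = v at *
  simp only [List.mem_filter, decide_eq_true_eq, hV] at hv
  obtain ⟨⟨s', hs', rfl⟩, i, hi, hiv⟩ := hv
  have hmem' : i ∈ (List.range (window L x s').length).filter
      (fun i => decide (HasAt (3 * L) u (window L x s') i)) := by
    simp only [List.mem_filter, decide_eq_true_eq]
    exact ⟨hi, hiv⟩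
  have hi' := headD_mem (d := 0) (List.ne_nil_of_mem hmem')
  generalize ((List.range (window L x s').length).filter
      (fun i => decide (HasAt (3 * L) u (window L x s') i))).headD 0 = i' at *
  simp only [List.mem_filter, decide_eq_true_eq] at hi'
  rw [(hwin s' i' hi'.2).2, List.take_succ_eq_append_getElem hmx]

/-- Once the length of `x` is reached, `extend` does nothing, so more rounds than needed are
harmless. -/
theorem iterate_extend {L : ℕ} {x : List Bool} (hL : L ≠ 0) (hx : BDistinct (3 * L) x)
    {V : List (List Bool)} (hV : ∀ v, v ∈ V ↔ ∃ s ∈ sample L x, window L x s = v) (j : ℕ) :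
    (extend (3 * L) x.length V)^[j] (x.take (8 * L)) = x.take (8 * L + j) := by
  induction j with
  | zero => rfl
  | succ j ih =>
    rw [Function.iterate_succ_apply', ih]
    rcases lt_or_ge (8 * L + j) x.length with h | h
    · rw [extend_take hL hx hV (Nat.le_add_right _ _) h]
      rfl
    · rw [List.take_of_length_le h, List.take_of_length_le (by omega), extend, if_neg (by omega)]

theorem reconstruct_message {n k t : ℕ} (hn : n ≠ 0) {x y : List Bool} (hxn : x.length = n)
    (hx : BDistinct (3 * lg n) x) (h : BlockEdits k t x y) :
    reconstruct n k t (message n k t x) y = x := by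
  have := iterate_extend (lg_ne_zero n) hx (fun v => mem_map_decode hn h) n
  rw [hxn] at this
  rw [reconstruct, drop_message, this, List.take_of_length_le (by omega)]

end DocExchange

namespace DocExchange

open Enc

/-! ### The programs of Alice and Bob -/

/-- The smaller one of two numbers, in time linear in the first one. -/
def minProg : Prog :=
  .seq (.seq (.pair .head (.pair .tail .nil))
    (.while (.ifNil .head .nil (.seq .tail .head))
      (.pair (.seq .head .tail) (.pair (.seq .tail (.seq .head .tail))
        (.pair .nil (.seq .tail .tail)))))) (.seq .tail .tail)

/-- Both numbers are decremented together while `c` counts, and the loop stops as soon as one is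
empty. The time thus depends on `a` alone, however large `b` is. -/
theorem runsWithin_minProg_loop (a b c : ℕ) : ∃ v w, RunsWithin
    (.while (.ifNil .head .nil (.seq .tail .head))
      (.pair (.seq .head .tail) (.pair (.seq .tail (.seq .head .tail))
        (.pair .nil (.seq .tail .tail)))))
    (enc (a, b, c)) (.cons v (.cons w (enc (c + min a b)))) (30 * a + 10) := by
  induction a generalizing b c with
  | zero =>
    refine ⟨_, _, (RunsWithin.while_nil (RunsWithin.ifNil_nil (.of_runs (.head _))
      (.of_runs (.nil _)))).mono (by omega)⟩
  | succ a ih =>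
    cases b with
    | zero =>
      exact ⟨_, _, (RunsWithin.while_nil (RunsWithin.ifNil_cons (.of_runs (.head _))
        ((RunsWithin.of_runs (.tail _)).seq (.of_runs (.head _))))).mono (by omega)⟩
    | succ b =>
      obtain ⟨v, w, h⟩ := ih b (c + 1)
      refine ⟨v, w, ?_⟩
      have hcond := RunsWithin.ifNil_cons (q := .nil) (.of_runs (.head (enc (a + 1, b + 1, c))))
        ((RunsWithin.of_runs (.tail (enc (a + 1, b + 1, c)))).seq (.of_runs (.head _)))
      have hbody := ((RunsWithin.of_runs (.head (enc (a + 1, b + 1, c)))).seq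
        (.of_runs (.tail _))).pair (((RunsWithin.of_runs (.tail (enc (a + 1, b + 1, c)))).seq
          ((RunsWithin.of_runs (.head _)).seq (.of_runs (.tail _)))).pair
            ((RunsWithin.of_runs (.nil (enc (a + 1, b + 1, c)))).pair
              ((RunsWithin.of_runs (.tail (enc (a + 1, b + 1, c)))).seq (.of_runs (.tail _)))))
      rw [show c + min (a + 1) (b + 1) = c + 1 + min a b by omega]
      exact (RunsWithin.while_cons hcond hbody h).mono (by omega)

theorem runsWithin_minProg (a b : ℕ) :
    RunsWithin minProg (enc (a, b)) (enc (min a b)) (30 * a + 20) := by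
  obtain ⟨v, w, h⟩ := runsWithin_minProg_loop a b 0
  rw [zero_add] at h
  have hinit := (RunsWithin.of_runs (.head (enc (a, b)))).pair
    ((RunsWithin.of_runs (.tail (enc (a, b)))).pair (.of_runs (.nil _)))
  have hfinal := (RunsWithin.of_runs (.tail (.cons v (.cons w (enc (min a b)))))).seq
    (.of_runs (.tail _))
  have := (RunsWithin.seq hinit h).seq hfinal
  exact this.mono (by omega)

/-- Replace the parameters `k` and `t` by `min n k` and `min n t`. -/
def clip : Prog :=
  .pair .head (.pair (.seq (.pair .head (.seq .tail .head)) minProg)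
    (.pair (.seq (.pair .head (.seq .tail (.seq .tail .head))) minProg)
      (.seq .tail (.seq .tail .tail))))

/-- The time bound must be a polynomial in `n` only, although `k` and `t` come in unary without any
bound; later programs see only the clipped values. -/
theorem runsWithin_clip {α : Type} [Enc α] (n k t : ℕ) (a : α) :
    RunsWithin clip (enc (n, k, t, a)) (enc (n, min n k, min n t, a)) (60 * n + 70) :=
  ((RunsWithin.of_runs (.head _)).pair
    (((((RunsWithin.of_runs (.head _)).pair ((RunsWithin.of_runs (.tail _)).seq
      (.of_runs (.head _)))).seq (runsWithin_minProg n k))).pair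
    ((((RunsWithin.of_runs (.head _)).pair ((RunsWithin.of_runs (.tail _)).seq
      ((RunsWithin.of_runs (.tail _)).seq (.of_runs (.head _))))).seq
        (runsWithin_minProg n t)).pair ((RunsWithin.of_runs (.tail _)).seq
      ((RunsWithin.of_runs (.tail _)).seq (.of_runs (.tail _))))))).mono (by omega)

/-! ### The protocol with its exceptional cases -/

open scoped Classical in
/-- What Alice sends: nothing if there are no errors, the whole string if there may be too many,
and `message` otherwise. -/
noncomputable def aliceMessage (n k t : ℕ) (x : List Bool) : List Bool :=
  if k = 0 then [] else if n ≤ k ∨ n ≤ t then x else message n k t x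

theorem PT.aliceMessage : PT (fun a : ℕ × ℕ × ℕ × List Bool =>
    aliceMessage a.1 a.2.1 a.2.2.1 a.2.2.2) := by
  unfold DocExchange.aliceMessage
  fun_prop

theorem BlockEdits.length_le {k t : ℕ} {x y : List Bool} (h : BlockEdits k t x y) :
    y.length ≤ x.length + t := by
  induction h with
  | none => omega
  | step h _ ih =>
    cases h <;> simp only [List.length_append] at * <;> omega

theorem BlockEdits.eq_of_zero {t : ℕ} {x y : List Bool} (h : BlockEdits 0 t x y) : y = x := by
  generalize hk : 0 = k at h
  cases h with
  | none => rfl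
  | step => omega

theorem sz_bits_le (l : List Bool) : sz l ≤ 4 * l.length + 1 := by
  have := sz_list_le (l := l) (M := 3) fun b _ => sz_bool_le b
  omega

section

variable {α β γ δ ε : Type} [Enc α] [Enc β] [Enc γ] [Enc δ] [Enc ε]
  (a : α) (b : β) (c : γ) (d : δ) (e : ε)

theorem runsWithin_proj₂ : RunsWithin (.seq .tail .head) (enc (a, b, c)) (enc b) 3 :=
  (RunsWithin.of_runs (.tail _)).seq (.of_runs (.head _))

theorem runsWithin_proj₄ : RunsWithin (.seq .tail (.seq .tail (.seq .tail .head)))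
    (enc (a, b, c, d, e)) (enc d) 7 :=
  (RunsWithin.of_runs (.tail _)).seq ((RunsWithin.of_runs (.tail _)).seq
    ((RunsWithin.of_runs (.tail _)).seq (.of_runs (.head _))))

theorem runsWithin_proj₅ : RunsWithin (.seq .tail (.seq .tail (.seq .tail .tail)))
    (enc (a, b, c, d, e)) (enc e) 7 :=
  (RunsWithin.of_runs (.tail _)).seq ((RunsWithin.of_runs (.tail _)).seq
    ((RunsWithin.of_runs (.tail _)).seq (.of_runs (.tail _))))

theorem runsWithin_proj₁₂₃ :
    RunsWithin (.pair .head (.pair (.seq .tail .head) (.seq .tail (.seq .tail .head))))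
      (enc (a, b, c, d)) (enc (a, b, c)) 11 :=
  (RunsWithin.of_runs (.head _)).pair (((RunsWithin.of_runs (.tail _)).seq
    (.of_runs (.head _))).pair ((RunsWithin.of_runs (.tail _)).seq
      ((RunsWithin.of_runs (.tail _)).seq (.of_runs (.head _)))))

end

/-- Bob's program after `clip`, made from the program `p` for the main case and the program `q` that
tests for many errors. -/
def bobCases (p q : Prog) : Prog :=
  .ifNil (.seq .tail .head) (.seq .tail (.seq .tail (.seq .tail .tail)))
    (.ifNil (.seq (.pair .head (.pair (.seq .tail .head) (.seq .tail (.seq .tail .head)))) q)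
      p (.seq .tail (.seq .tail (.seq .tail .head))))

theorem exists_exchange_programs : ∃ (alice bob : Prog) (T : Polynomial ℕ),
    ∀ n : ℕ, 16 ≤ n → ∀ k t : ℕ, ∀ x : List Bool, x.length = n → BDistinct (3 * lg n) x →
      RunsWithin alice (aliceInput n k t x) (Data.ofBits (aliceMessage n (min n k) (min n t) x))
        (T.eval n) ∧
      ∀ y, BlockEdits k t x y →
        RunsWithin bob (bobInput n k t (aliceMessage n (min n k) (min n t) x) y) (Data.ofBits x)
          (T.eval n) := by
  obtain ⟨pa, Ta, ha⟩ := PT.aliceMessage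
  obtain ⟨pb, Tb, hb⟩ : PT (fun a : ℕ × ℕ × ℕ × List Bool × List Bool =>
      reconstruct a.1 a.2.1 a.2.2.1 a.2.2.2.1 a.2.2.2.2) := by fun_prop
  obtain ⟨pc, Tc, hc⟩ : PT (fun a : ℕ × ℕ × ℕ => a.1 ≤ a.2.1 ∨ a.1 ≤ a.2.2) := by fun_prop
  let A : Polynomial ℕ := 20 * Polynomial.X + 20
  refine ⟨.seq clip pa,
    .seq clip (bobCases pb pc),
    60 * Polynomial.X + 200 + Ta.comp A + Tc.comp A + Tb.comp (A + Ta.comp A),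
    fun n hn k t x hxn hx => ?_⟩
  have hszx := sz_bits_le x
  have hsza : sz (n, min n k, min n t, x) ≤ A.eval n := by
    simp only [sz_pair, sz_nat, A, Polynomial.eval_add, Polynomial.eval_mul,
      Polynomial.eval_ofNat, Polynomial.eval_X]
    omega
  have hszc : sz (n, min n k, min n t) ≤ A.eval n := by
    simp only [sz_pair, sz_nat, A, Polynomial.eval_add, Polynomial.eval_mul,
      Polynomial.eval_ofNat, Polynomial.eval_X]
    omega
  have hTa := eval_mono Ta hsza
  have hTc := eval_mono Tc hszc
  have hae := (ha (n, min n k, min n t, x)).1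
  have hasz := (ha (n, min n k, min n t, x)).2
  simp only at hae hasz
  constructor
  · rw [← enc_eq_ofBits]
    have hin : aliceInput n k t x = enc (n, k, t, x) := by
      rw [aliceInput, ← enc_eq_ofBits]
      rfl
    rw [hin]
    refine ((runsWithin_clip n k t x).seq hae).mono ?_
    simp only [Polynomial.eval_add, Polynomial.eval_mul, Polynomial.eval_ofNat,
      Polynomial.eval_X, Polynomial.eval_comp]
    omega
  · intro y hy
    generalize hmsg : aliceMessage n (min n k) (min n t) x = msg at *
    have hin : bobInput n k t msg y = enc (n, k, t, msg, y) := by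
      rw [bobInput, ← enc_eq_ofBits, ← enc_eq_ofBits]
      rfl
    rw [← enc_eq_ofBits, hin]
    suffices hmain : RunsWithin (bobCases pb pc) (enc (n, min n k, min n t, msg, y)) (enc x)
        (120 + Tc.eval (A.eval n) + Tb.eval (A.eval n + Ta.eval (A.eval n))) by
      refine ((runsWithin_clip n k t (msg, y)).seq hmain).mono ?_
      simp only [Polynomial.eval_add, Polynomial.eval_mul, Polynomial.eval_ofNat,
        Polynomial.eval_X, Polynomial.eval_comp]
      omega
    unfold bobCases
    have hk := runsWithin_proj₂ n (min n k) (min n t, msg, y)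
    rcases Nat.eq_zero_or_pos k with rfl | hk0
    · obtain rfl := hy.eq_of_zero
      rw [Nat.min_zero] at hk ⊢
      change RunsWithin _ _ .nil _ at hk
      have hrun := RunsWithin.ifNil_nil (r := (.ifNil (.seq (.pair .head (.pair (.seq .tail .head)
        (.seq .tail (.seq .tail .head)))) pc) pb (.seq .tail (.seq .tail (.seq .tail .head)))))
        hk (runsWithin_proj₅ n 0 (min n t) msg y)
      exact hrun.mono (by omega)
    obtain ⟨k', hk'⟩ : ∃ k', min n k = k' + 1 := ⟨min n k - 1, by omega⟩
    have hbranch := (runsWithin_proj₁₂₃ n (min n k) (min n t) (msg, y)).seq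
      (hc (n, min n k, min n t)).1
    replace hk : RunsWithin (.seq .tail .head) (enc (n, min n k, min n t, msg, y))
        (.cons .nil (enc k')) 3 := by
      rw [← enc_succ, ← hk']
      exact hk
    refine RunsWithin.mono (S := 3 + (110 + Tc.eval (A.eval n) +
      Tb.eval (A.eval n + Ta.eval (A.eval n))) + 1) (RunsWithin.ifNil_cons hk ?_) (by omega)
    -- With many errors the message is `x` itself and Bob returns it without touching `y`, whose
    -- length need not be bounded in terms of `n`.
    by_cases hbig : n ≤ min n k ∨ n ≤ min n t
    · simp only at hbranch
      rw [enc_of_true hbig] at hbranch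
      have hx' : msg = x := by
        rw [← hmsg, aliceMessage, if_neg (by omega), if_pos hbig]
      subst hx'
      exact (RunsWithin.ifNil_cons hbranch
        (runsWithin_proj₄ n (min n k) (min n t) msg y)).mono (by omega)
    · simp only at hbranch
      rw [enc_of_not hbig] at hbranch
      have hk1 : min n k = k := by omega
      have ht1 : min n t = t := by omega
      have hx' : msg = message n k t x := by
        rw [← hmsg, aliceMessage, if_neg (by omega), if_neg hbig, hk1, ht1]
      -- Here `t < n`, so `y` has fewer than `2 * n` symbols and the time of the main program is
      -- polynomial in `n`.
      have hlen := hy.length_le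
      have hszy := sz_bits_le y
      have hrun := (hb (n, min n k, min n t, msg, y)).1
      simp only at hrun
      rw [hk1, ht1] at hrun hbranch hasz hTa hTc ⊢
      have hTb := eval_mono Tb (a := sz (n, k, t, msg, y))
        (b := A.eval n + Ta.eval (A.eval n)) (by
          have hA : A.eval n = 20 * n + 20 := by simp [A]
          simp only [sz_pair, sz_nat]
          omega)
      rw [hx', reconstruct_message (by omega) hxn hx hy, ← hx'] at hrun
      exact (RunsWithin.ifNil_nil hbranch hrun).mono (by omega)

/-! ### The communication cost -/

open Real

theorem logb_le_lg (n : ℕ) : logb 2 n ≤ lg n := by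
  rcases Nat.eq_zero_or_pos n with rfl | hn
  · simp
  rw [logb_le_iff_le_rpow (by norm_num) (by exact_mod_cast hn), rpow_natCast]
  exact_mod_cast (lt_two_pow_lg n).le

/-- The factor `16` leaves room for the additive constants in the widths of the colours. -/
theorem natLog_le_four_add_logb {m : ℕ} {r : ℝ} (hm : m ≠ 0) (hr : 0 < r) (h : (m : ℝ) ≤ 16 * r) :
    (Nat.log 2 m : ℝ) ≤ 4 + logb 2 r := by
  have h1 : (Nat.log 2 m : ℝ) ≤ logb 2 m := by exact_mod_cast Real.natLog_le_logb m 2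
  have h2 : logb 2 m ≤ logb 2 (16 * r) :=
    logb_le_logb_of_le (by norm_num) (by exact_mod_cast Nat.pos_of_ne_zero hm) h
  rw [logb_mul (by norm_num) hr.ne', show (16 : ℝ) = 2 ^ (4 : ℝ) by norm_num,
    logb_rpow (by norm_num) (by norm_num)] at h2
  linarith

theorem lg_le_logb_add_one (n : ℕ) : (lg n : ℝ) ≤ logb 2 n + 1 := by
  rw [lg, Nat.cast_add, Nat.cast_one]
  exact add_le_add_left (by exact_mod_cast Real.natLog_le_logb n 2) 1

theorem isTheta_lg : Asymptotics.IsTheta Filter.atTop (fun n : ℕ => ((3 * lg n : ℕ) : ℝ))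
    (fun n : ℕ => logb 2 n) := by
  constructor
  · refine Asymptotics.IsBigO.of_bound 6 (Filter.eventually_atTop.2 ⟨2, fun n hn => ?_⟩)
    have h1 : (1 : ℝ) ≤ logb 2 n := by
      rw [le_logb_iff_rpow_le (by norm_num) (by positivity)]
      simpa using hn
    have h2 := lg_le_logb_add_one n
    rw [norm_of_nonneg (by positivity), norm_of_nonneg (by linarith)]
    push_cast
    linarith
  · refine Asymptotics.IsBigO.of_bound 1 (Filter.eventually_atTop.2 ⟨2, fun n hn => ?_⟩)
    have h1 : (0 : ℝ) ≤ logb 2 n := logb_nonneg (by norm_num) (by exact_mod_cast (by omega : 1 ≤ n))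
    have h2 := logb_le_lg n
    rw [norm_of_nonneg h1, norm_of_nonneg (by positivity)]
    push_cast
    linarith

/-- From `n = 16` on the triple logarithm is at least `1`, so that additive constants can be
absorbed into it. -/
theorem logs_ge {n : ℕ} (hn : 16 ≤ n) :
    4 ≤ logb 2 n ∧ 2 ≤ logb 2 (logb 2 n) ∧ 1 ≤ logb 2 (logb 2 (logb 2 n)) := by
  have h1 : 4 ≤ logb 2 n := by
    rw [le_logb_iff_rpow_le (by norm_num) (by positivity)]
    norm_num
    exact_mod_cast hn
  have h2 : 2 ≤ logb 2 (logb 2 n) := by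
    rw [le_logb_iff_rpow_le (by norm_num) (by linarith)]
    norm_num
    exact h1
  refine ⟨h1, h2, ?_⟩
  rw [le_logb_iff_rpow_le (by norm_num) (by linarith)]
  norm_num
  exact h2

theorem numColours_le {n : ℕ} (hn : 16 ≤ n) :
    (numColours (lg n) : ℝ) ≤ 21 * logb 2 (logb 2 (logb 2 n)) := by
  obtain ⟨h1, h2, h3⟩ := logs_ge hn
  have hL := lg_le_logb_add_one n
  have hw₁ : (width₁ (lg n) : ℝ) ≤ 5 + logb 2 (logb 2 n) := by
    have := natLog_le_four_add_logb (m := 9 * lg n + 3) (r := logb 2 n) (by omega) (by linarith) (by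
      push_cast
      linarith)
    rw [width₁]
    push_cast
    linarith
  have hw₂ : (width₂ (lg n) : ℝ) ≤ 5 + logb 2 (logb 2 (logb 2 n)) := by
    have := natLog_le_four_add_logb (m := 3 * width₁ (lg n) + 3) (r := logb 2 (logb 2 n)) (by omega)
      (by linarith) (by
        push_cast
        linarith)
    rw [width₂]
    push_cast
    linarith
  -- For `c` the triple logarithm, `3 * (5 + c) + 3 ≤ 21 * c` because `1 ≤ c`.
  rw [numColours]
  push_cast
  linarith

theorem length_message_le_mul {n k t : ℕ} (hn : 16 ≤ n) (hk : k ≠ 0) (x : List Bool) :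
    ((message n k t x).length : ℝ) ≤
      200000 * (k * logb 2 n * logb 2 (logb 2 (logb 2 n)) + t) := by
  obtain ⟨h1, -, h3⟩ := logs_ge hn
  have hL := lg_le_logb_add_one n
  have hK := numColours_le hn
  have hL1 : 1 ≤ lg n := Nat.one_le_iff_ne_zero.2 (lg_ne_zero n)
  -- The density of the samples, one per `dist (lg n) > lg n / 2` symbols, cancels the `O(log n)`
  -- bits per residue; hence `t` enters the cost without a logarithm.
  have hD : t / dist (lg n) * lg n ≤ 2 * t :=
    calc t / dist (lg n) * lg n ≤ t / dist (lg n) * (2 * dist (lg n)) :=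
          Nat.mul_le_mul_left _ (lt_two_mul_dist (lg_ne_zero n)).le
      _ = 2 * (t / dist (lg n) * dist (lg n)) := by ring
      _ ≤ 2 * t := Nat.mul_le_mul_left 2 (Nat.div_mul_le_self _ _)
  have hlen : (message n k t x).length ≤
      38 * (k * (64 * numColours (lg n) + 600) * lg n) + 152 * t + 8 * lg n :=
    calc _ ≤ 2 * errorBound n k t * residueWidth n + 8 * lg n := length_message_le n k t x
      _ ≤ 2 * errorBound n k t * (19 * lg n) + 8 * lg n := by
          unfold residueWidth
          gcongr
          omega
      _ = 38 * (k * (64 * numColours (lg n) + 600) * lg n) +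
          76 * (t / dist (lg n) * lg n) + 8 * lg n := by unfold errorBound; ring
      _ ≤ _ := by omega
  have hk1 : (1 : ℝ) ≤ k := by exact_mod_cast Nat.one_le_iff_ne_zero.2 hk
  generalize logb 2 n = a at *
  generalize logb 2 (logb 2 a) = b at *
  -- Since `k` is positive, the prefix of `8 * lg n` bits is absorbed into the first term. This is
  -- why the case `k = 0` is separate.
  have hab : a ≤ k * a * b := by
    calc a = 1 * a * 1 := by ring
      _ ≤ k * a * b := by gcongr
  have ht : (0 : ℝ) ≤ t := by positivity
  calc ((message n k t x).length : ℝ)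
      ≤ 38 * (k * (64 * numColours (lg n) + 600) * lg n) + 152 * t + 8 * lg n := by
        exact_mod_cast hlen
    _ ≤ 38 * (k * (64 * (21 * b) + 600 * b) * (2 * a)) + 152 * t + 8 * (2 * a) := by
        gcongr <;> linarith
    _ = 147744 * (k * a * b) + 152 * t + 16 * a := by ring
    _ ≤ _ := by linarith

theorem length_aliceMessage_le {n : ℕ} (hn : 16 ≤ n) (k t : ℕ) {x : List Bool}
    (hx : x.length = n) : ((aliceMessage n (min n k) (min n t) x).length : ℝ) ≤
      200000 * (k * logb 2 n * logb 2 (logb 2 (logb 2 n)) + t) := by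
  obtain ⟨h1, -, h3⟩ := logs_ge hn
  have ht : (0 : ℝ) ≤ t := by positivity
  have hk : (k : ℝ) ≤ k * logb 2 n * logb 2 (logb 2 (logb 2 n)) :=
    calc (k : ℝ) = k * 1 * 1 := by ring
      _ ≤ _ := by gcongr; linarith
  have hk0 : (0 : ℝ) ≤ k := by positivity
  unfold aliceMessage
  split_ifs with hz hbig
  · simp only [List.length_nil, Nat.cast_zero]
    linarith
  · have : (n : ℝ) ≤ k + t := by
      exact_mod_cast (by omega : n ≤ k + t)
    rw [hx]
    linarith
  · rw [show min n k = k by omega, show min n t = t by omega]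
    exact length_message_le_mul hn (by omega) x

end DocExchange

theorem mainTheorem4 :
    ∃ B : ℕ → ℕ,
      Asymptotics.IsTheta Filter.atTop (fun n : ℕ => (B n : ℝ)) (fun n : ℕ => Real.logb 2 n) ∧
      (∀ n : ℕ, 3 * Real.logb 2 n ≤ B n) ∧
      ∃ (alice bob : DocExchange.Prog) (C : ℝ) (P : Polynomial ℕ),
        ∀ n : ℕ, 16 ≤ n → ∀ k t : ℕ, ∀ x : List Bool, x.length = n →
          DocExchange.BDistinct (B n) x →
          DocExchange.Exchanges alice bob k t x
            (C * (k * Real.logb 2 n * Real.logb 2 (Real.logb 2 (Real.logb 2 n)) + t))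
            (P.eval n) := by
  obtain ⟨alice, bob, T, h⟩ := DocExchange.exists_exchange_programs
  refine ⟨fun n => 3 * DocExchange.lg n, DocExchange.isTheta_lg, fun n => ?_, alice, bob, 200000,
    T, fun n hn k t x hx hd => ?_⟩
  · have := DocExchange.logb_le_lg n
    push_cast
    linarith
  · obtain ⟨ha, hb⟩ := h n hn k t x hx hd
    refine ⟨DocExchange.aliceMessage n (min n k) (min n t) x, ?_,
      DocExchange.length_aliceMessage_le hn k t hx, ?_⟩
    · rwa [hx]
    · rwa [hx]
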